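/- **Setting.** Let $p$ be a prime and let $\Gamma$ be a finite set of parties. A *pair* is an unordered pair $\{T_1,T_2\}$ of disjoint subsets of $\Gamma$. For pairs write $\{T_1,T_2\}\preceq\{T_3,T_4\}$ if ($T_1\subseteq T_3$ and $T_2\subseteq T_4$) or ($T_1\subseteq T_4$ and $T_2\subseteq T_3$), and $X\prec Y$ if $X\preceq Y$ and $X\ne Y$. Let $\mathcal A$ be a set of pairs (the *authorized* pairs), and let $\mathcal U$, the set of *unauthorized* pairs, consist of all pairs that are not in $\mathcal A$. *Stabilizer states.* Consider finitely many $p$-dimensional qudits with operators $X|j\rangle=|j+1\rangle$, $Z|j\rangle=\omega^j|j\rangle$, $\omega=e^{2\pi i/p}$. A stabilizer group is an abelian group $S$ of Pauli operators (phases times tensor products of operators $X^aZ^b$) with $e^{i\phi}I\notin S$ whenever $e^{i\phi}\neq1$. The corresponding stabilizer state is the (generally mixed) maximally mixed state on the common $+1$ eigenspace of $S$. *Stabilizer ESS with a known partner.* $\mathcal A$ is *realized by a stabilizer entanglement sharing scheme* over $p$-dimensional qudits if there are finitely many $p$-dimensional qudits, each handed to one of the parties (a party may hold any number of them), and a stabilizer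 state $\rho$ of these qudits such that 1. for every $\{T_1,T_2\}\in\mathcal A$ there are quantum channels $\mathcal N_1$ from the qudits of $T_1$ to one $p$-dimensional system and $\mathcal N_2$ from the qudits of $T_2$ to another, which may depend on the pair, with $(\mathcal N_1\otimes\mathcal N_2)(\rho_{T_1T_2})=\Psi^+$, where $\Psi^+$ is the projector on $|\Psi^+\rangle=p^{-1/2}\sum_{j\in\mathbb F_p}|j\rangle|j\rangle$; 2. there is $\delta>0$ such that for every $\{T_1,T_2\}\in\mathcal U$ and all such channels $\mathcal N_1,\mathcal N_2$ one has $\langle\Psi^+|(\mathcal N_1\otimes\mathcal N_2)(\rho_{T_1T_2})|\Psi^+\rangle\le 1-\delta$. *The matrices.* Let $\mathcal A_{\min}$ be the set of $A\in\mathcal A$ such that no $A'\in\mathcal A$ satisfies $A'\prec A$. Fix an arbitrary ordering $(T_1,T_2)$ of the two members of every pair. For $A=\{T_1,T_2\}\in\mathcal A_{\min}$ let $\mathcal U(A)=\{\{T_1',T_2'\}\in\mathcal U : T_1'\cup T_2'=T_1\cup T_2\}$. Let $M(A)$ be the $0/1$ matrix over $\mathbb F_p$ with columns indexed by $T_1\cup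 T_2$, with one row for each $U\in\mathcal U(A)$, namely the indicator vector of the first member of $U$, and with one more row consisting of ones. Let $\tilde M(A)$ be $M(A)$ with one further row, the indicator vector of the first member of $A$. **Theorem.** $\mathcal A$ can be realized by a stabilizer entanglement sharing scheme with a known partner over $p$-dimensional qudits if and only if 1. (monotonicity) for all pairs $A,A'$ with $A\in\mathcal A$ and $A\preceq A'$ one has $A'\in\mathcal A$; and 2. for every $A\in\mathcal A_{\min}$, $\operatorname{rank}M(A)<\operatorname{rank}\tilde M(A)$, with ranks over $\mathbb F_p$. -/

import Mathlib

noncomputable section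

namespace EntanglementSharing

/-! ### Pairs of disjoint sets of parties and pair access structures -/

section Pairs

variable {Γ : Type*} [DecidableEq Γ]

/-- An unordered pair `{T₁, T₂}` of disjoint sets of parties. -/
def PartyPair (Γ : Type*) [DecidableEq Γ] : Type _ :=
  {X : Sym2 (Finset Γ) // ∀ T₁ T₂ : Finset Γ, X = s(T₁, T₂) → Disjoint T₁ T₂}

/-- The union `T₁ ∪ T₂` of the two members of an unordered pair. -/
def PartyPair.union (X : PartyPair Γ) : Finset Γ :=
  Sym2.lift ⟨fun T₁ T₂ => T₁ ∪ T₂, fun T₁ T₂ => Finset.union_comm T₁ T₂⟩ X.1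

/-- The order `X ⪯ Y` on unordered pairs: the members of `X` and `Y` can be matched so that each
member of `X` is contained in the corresponding member of `Y`. -/
def PartyPair.Below (X Y : PartyPair Γ) : Prop :=
  ∃ T₁ T₂ T₃ T₄ : Finset Γ, X.1 = s(T₁, T₂) ∧ Y.1 = s(T₃, T₄) ∧ T₁ ⊆ T₃ ∧ T₂ ⊆ T₄

/-- The strict order `X ≺ Y`. -/
def PartyPair.StrictlyBelow (X Y : PartyPair Γ) : Prop :=
  X.Below Y ∧ X ≠ Y

/-- In terms of given representatives, `X ⪯ Y` is the usual disjunction of the two matchings. -/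
theorem PartyPair.below_iff {X Y : PartyPair Γ} {T₁ T₂ T₃ T₄ : Finset Γ}
    (hX : X.1 = s(T₁, T₂)) (hY : Y.1 = s(T₃, T₄)) :
    X.Below Y ↔ (T₁ ⊆ T₃ ∧ T₂ ⊆ T₄) ∨ (T₁ ⊆ T₄ ∧ T₂ ⊆ T₃) := by
  constructor
  · rintro ⟨A, B, C, D, h1, h2, h3, h4⟩
    rw [hX, Sym2.eq_iff] at h1
    rw [hY, Sym2.eq_iff] at h2
    rcases h1 with ⟨rfl, rfl⟩ | ⟨rfl, rfl⟩ <;> rcases h2 with ⟨rfl, rfl⟩ | ⟨rfl, rfl⟩ <;> tauto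
  · rintro (⟨h1, h2⟩ | ⟨h1, h2⟩)
    · exact ⟨T₁, T₂, T₃, T₄, hX, hY, h1, h2⟩
    · exact ⟨T₁, T₂, T₄, T₃, hX, hY.trans Sym2.eq_swap, h1, h2⟩

/-- A pair access structure: a set of authorized pairs and a set of unauthorized pairs. -/
structure PairAccessStructure (Γ : Type*) [DecidableEq Γ] where
  authorized : Set (PartyPair Γ)
  unauthorized : Set (PartyPair Γ)

/-- The pair access structure determined by its authorized pairs: every pair which is not
authorized is unauthorized. -/
def PairAccessStructure.ofAuthorized (𝒜 : Set (PartyPair Γ)) : PairAccessStructure Γ where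
  authorized := 𝒜
  unauthorized := 𝒜ᶜ

/-- Monotonicity: every pair above an authorized pair is authorized. -/
def PairAccessStructure.IsMonotone (𝒮 : PairAccessStructure Γ) : Prop :=
  ∀ A A' : PartyPair Γ, A ∈ 𝒮.authorized → A.Below A' → A' ∈ 𝒮.authorized

/-- The set `𝒜_min` of minimal authorized pairs. -/
def PairAccessStructure.minimalAuthorized (𝒮 : PairAccessStructure Γ) : Set (PartyPair Γ) :=
  {A | A ∈ 𝒮.authorized ∧ ¬ ∃ A' ∈ 𝒮.authorized, A'.StrictlyBelow A}

/-- The set `𝒰(A)` of unauthorized pairs `{T₁', T₂'}` with `T₁' ∪ T₂' = T₁ ∪ T₂`. -/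
def PairAccessStructure.unauthorizedOver (𝒮 : PairAccessStructure Γ) (A : PartyPair Γ) :
    Set (PartyPair Γ) :=
  {U | U ∈ 𝒮.unauthorized ∧ U.union = A.union}

/-- A choice, for every unordered pair, of an ordering `(T₁, T₂)` of its two members. -/
def IsOrdering (ord : PartyPair Γ → Finset Γ × Finset Γ) : Prop :=
  ∀ X : PartyPair Γ, X.1 = s((ord X).1, (ord X).2)

/-- The matrix `M(A)` over `𝔽_p`. The columns are indexed by the parties in `T₁ ∪ T₂`. There is
one row for each `U ∈ 𝒰(A)`, the indicator of the first component of `U`, and a last row of ones. -/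
def matM (p : ℕ) (ord : PartyPair Γ → Finset Γ × Finset Γ) (𝒮 : PairAccessStructure Γ)
    (A : PartyPair Γ) : Matrix (𝒮.unauthorizedOver A ⊕ Unit) A.union (ZMod p) :=
  Matrix.of fun row s =>
    match row with
    | Sum.inl U => if s.1 ∈ (ord U.1).1 then 1 else 0
    | Sum.inr _ => 1

/-- The matrix `M̃(A)`: the rows of `M(A)` followed by the indicator of the first component
of `A`. -/
def matMTilde (p : ℕ) (ord : PartyPair Γ → Finset Γ × Finset Γ) (𝒮 : PairAccessStructure Γ)
    (A : PartyPair Γ) : Matrix ((𝒮.unauthorizedOver A ⊕ Unit) ⊕ Unit) A.union (ZMod p) :=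
  Matrix.of fun row s =>
    match row with
    | Sum.inl r => matM p ord 𝒮 A r s
    | Sum.inr _ => if s.1 ∈ (ord A).1 then 1 else 0

end Pairs

/-! ### Pauli operators and stabilizer states of `p`-dimensional qudits

A system of qudits labelled by `Q` has computational basis `Q → ZMod p`. -/

section Stabilizer

variable (p : ℕ) [NeZero p]

/-- The shift operator `X |j⟩ = |j + 1⟩`. -/
def pauliX : Matrix (ZMod p) (ZMod p) ℂ :=
  Matrix.of fun i j => if i = j + 1 then 1 else 0

/-- The clock operator `Z |j⟩ = ω ^ j |j⟩` with `ω = exp (2 π i / p)`. -/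
def pauliZ : Matrix (ZMod p) (ZMod p) ℂ :=
  Matrix.diagonal fun j => Complex.exp (2 * Real.pi * Complex.I / p) ^ j.val

variable {Q : Type*} [Fintype Q] [DecidableEq Q]

/-- The Pauli string `⨂_q X ^ (a q) Z ^ (b q)`. -/
def pauliString (a b : Q → ZMod p) : Matrix (Q → ZMod p) (Q → ZMod p) ℂ :=
  Matrix.of fun i j => ∏ q, (pauliX p ^ (a q).val * pauliZ p ^ (b q).val) (i q) (j q)

variable {p}

/-- A stabilizer group: an abelian group of Pauli operators (Pauli strings times a phase) that
contains no scalar multiple of the identity except the identity. -/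
structure IsStabilizerGroup (S : Subgroup (Matrix.unitaryGroup (Q → ZMod p) ℂ)) : Prop where
  pauli : ∀ g ∈ S, ∃ (c : ℂ) (a b : Q → ZMod p), ‖c‖ = 1 ∧
    (g : Matrix (Q → ZMod p) (Q → ZMod p) ℂ) = c • pauliString p a b
  comm : ∀ g ∈ S, ∀ h ∈ S, g * h = h * g
  no_phase : ∀ g ∈ S, ∀ c : ℂ,
    (g : Matrix (Q → ZMod p) (Q → ZMod p) ℂ) = c • (1 : Matrix (Q → ZMod p) (Q → ZMod p) ℂ) → c = 1

/-- `ρ` is the stabilizer state of `S`: the maximally mixed state on the common `+1` eigenspace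
of `S`. The Hermitian idempotent `P` is the orthogonal projection onto that eigenspace. -/
def IsStabilizerStateOf (S : Subgroup (Matrix.unitaryGroup (Q → ZMod p) ℂ))
    (ρ : Matrix (Q → ZMod p) (Q → ZMod p) ℂ) : Prop :=
  ∃ P : Matrix (Q → ZMod p) (Q → ZMod p) ℂ, P.IsHermitian ∧ P * P = P ∧
    (∀ v : (Q → ZMod p) → ℂ, P.mulVec v = v ↔
      ∀ g ∈ S, (g : Matrix (Q → ZMod p) (Q → ZMod p) ℂ).mulVec v = v) ∧
    ρ = P.trace⁻¹ • P

/-- `ρ` is a (possibly mixed) stabilizer state. -/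
def IsStabilizerState (ρ : Matrix (Q → ZMod p) (Q → ZMod p) ℂ) : Prop :=
  ∃ S : Subgroup (Matrix.unitaryGroup (Q → ZMod p) ℂ),
    IsStabilizerGroup S ∧ IsStabilizerStateOf S ρ

end Stabilizer

/-! ### Reduced states, local channels, entanglement sharing schemes -/

/-- A quantum channel from an `m`-system to a `k`-system, given by finitely many Kraus
operators. -/
structure Channel (m k : Type*) [Fintype m] [DecidableEq m] [Fintype k] where
  num : ℕ
  kraus : Fin num → Matrix k m ℂ
  complete : ∑ i, (kraus i).conjTranspose * kraus i = 1

/-- The action `(𝒩₁ ⊗ 𝒩₂)(σ)` of a product of local channels on a bipartite operator. -/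
def Channel.applyProd {m₁ k₁ m₂ k₂ : Type*} [Fintype m₁] [DecidableEq m₁] [Fintype k₁]
    [Fintype m₂] [DecidableEq m₂] [Fintype k₂] (N₁ : Channel m₁ k₁) (N₂ : Channel m₂ k₂)
    (σ : Matrix (m₁ × m₂) (m₁ × m₂) ℂ) : Matrix (k₁ × k₂) (k₁ × k₂) ℂ :=
  ∑ i, ∑ j, Matrix.kronecker (N₁.kraus i) (N₂.kraus j) * σ *
    (Matrix.kronecker (N₁.kraus i) (N₂.kraus j)).conjTranspose

section Schemes

variable (p : ℕ) [NeZero p]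

/-- The vector `|Ψ⁺⟩ = p^(-1/2) ∑_j |j⟩|j⟩`. -/
def eprVec : ZMod p × ZMod p → ℂ :=
  fun jk => if jk.1 = jk.2 then ((Real.sqrt p)⁻¹ : ℝ) else 0

/-- The `p`-dimensional EPR state `Ψ⁺ = |Ψ⁺⟩⟨Ψ⁺|`. -/
def eprState : Matrix (ZMod p × ZMod p) (ZMod p × ZMod p) ℂ :=
  Matrix.vecMulVec (eprVec p) (star (eprVec p))

/-- The fidelity `⟨Ψ⁺| σ |Ψ⁺⟩` of `σ` with the pure state `Ψ⁺`. -/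
def eprFidelity (σ : Matrix (ZMod p × ZMod p) (ZMod p × ZMod p) ℂ) : ℝ :=
  (star (eprVec p) ⬝ᵥ σ.mulVec (eprVec p)).re

variable {p}
variable {Γ : Type*} [DecidableEq Γ] {Q : Type*} [Fintype Q] [DecidableEq Q]

/-- The qudits held by the set `T` of parties, where `owner q` is the party holding `q`. -/
abbrev Held (owner : Q → Γ) (T : Finset Γ) : Type _ :=
  {q : Q // owner q ∈ T}

/-- The qudits held by no party of `T₁` or `T₂`. -/
abbrev Rest (owner : Q → Γ) (T₁ T₂ : Finset Γ) : Type _ :=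
  {q : Q // owner q ∉ T₁ ∧ owner q ∉ T₂}

/-- The basis state of the whole system with given restrictions to the qudits of `T₁`, to those
of `T₂`, and to the rest (`T₁` and `T₂` are disjoint). -/
def glue (owner : Q → Γ) (T₁ T₂ : Finset Γ) (x : Held owner T₁ → ZMod p)
    (y : Held owner T₂ → ZMod p) (z : Rest owner T₁ T₂ → ZMod p) : Q → ZMod p :=
  fun q =>
    if h₁ : owner q ∈ T₁ then x ⟨q, h₁⟩
    else if h₂ : owner q ∈ T₂ then y ⟨q, h₂⟩
    else z ⟨q, h₁, h₂⟩

/-- The reduced state `ρ_{T₁T₂}`: the partial trace of `ρ` over all qudits held by neither `T₁`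
nor `T₂`, as an operator on the bipartite system `T₁ : T₂`. -/
def reducedState (owner : Q → Γ) (ρ : Matrix (Q → ZMod p) (Q → ZMod p) ℂ) (T₁ T₂ : Finset Γ) :
    Matrix ((Held owner T₁ → ZMod p) × (Held owner T₂ → ZMod p))
      ((Held owner T₁ → ZMod p) × (Held owner T₂ → ZMod p)) ℂ :=
  Matrix.of fun i j => ∑ z : Rest owner T₁ T₂ → ZMod p,
    ρ (glue owner T₁ T₂ i.1 i.2 z) (glue owner T₁ T₂ j.1 j.2 z)

/-- `ρ`, with its qudits distributed by `owner`, is an entanglement sharing scheme with a known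
partner for the pair access structure `𝒮`: authorized pairs recover the `p`-dimensional EPR state
exactly by local channels, and for some `δ > 0` no unauthorized pair reaches by local channels
fidelity above `1 - δ` with it. -/
structure IsKnownPartnerESS (owner : Q → Γ) (ρ : Matrix (Q → ZMod p) (Q → ZMod p) ℂ)
    (𝒮 : PairAccessStructure Γ) : Prop where
  recover : ∀ A ∈ 𝒮.authorized, ∀ T₁ T₂ : Finset Γ, A.1 = s(T₁, T₂) →
    ∃ (N₁ : Channel (Held owner T₁ → ZMod p) (ZMod p))
      (N₂ : Channel (Held owner T₂ → ZMod p) (ZMod p)),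
      N₁.applyProd N₂ (reducedState owner ρ T₁ T₂) = eprState p
  secure : ∃ δ : ℝ, 0 < δ ∧ ∀ U ∈ 𝒮.unauthorized, ∀ T₁ T₂ : Finset Γ, U.1 = s(T₁, T₂) →
    ∀ (N₁ : Channel (Held owner T₁ → ZMod p) (ZMod p))
      (N₂ : Channel (Held owner T₂ → ZMod p) (ZMod p)),
      eprFidelity p (N₁.applyProd N₂ (reducedState owner ρ T₁ T₂)) ≤ 1 - δ

end Schemes

/-- `𝒮` is realized by a stabilizer entanglement sharing scheme with a known partner: finitely
many `p`-dimensional qudits in a stabilizer state, each handed to one of the parties. -/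
def RealizableByStabilizer (p : ℕ) [NeZero p] {Γ : Type*} [DecidableEq Γ]
    (𝒮 : PairAccessStructure Γ) : Prop :=
  ∃ (N : ℕ) (owner : Fin N → Γ) (ρ : Matrix (Fin N → ZMod p) (Fin N → ZMod p) ℂ),
    IsStabilizerState ρ ∧ IsKnownPartnerESS owner ρ 𝒮

end EntanglementSharing

end

/-!
A stabilizer group on qudits labelled by `Q` amounts to an additive group `L` of Pauli exponents
`(a, b)` together with phases `φ` such that the operators `φ w • pauli w`, `w ∈ L`, multiply as the
elements of `L` add (`IsPhase`). Its stabilizer state is `p ^ (-|Q|)` times the sum of these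
operators (`IsStabilizerState.exists_eq_stabState`, `IsPhase.isStabilizerState`), and tracing out
qudits keeps exactly the stabilizers supported on the remaining ones (`reducedState_stabState`).

What a pair `{T₁, T₂}` can do depends only on whether the stabilizers supported on `T₁ ∪ T₂` have
commuting restrictions to `T₁`. If two of the restrictions do not commute (`Linked`), they can be
rescaled to satisfy the relations of `X` and `Z`; each party then holds a virtual qudit, and
discarding the rest turns the stabilizers into `X ⊗ X` and `Z ⊗ Z⁻¹`, which determine the EPR state
(`IsPhase.exists_channels_of_linked`). If all restrictions commute, transposing the second tensor
factor of every stabilizer gives again a group of unitaries, so the reduced state has positive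
partial transpose; the partial transpose of the EPR state is the swap operator divided by `p`, so
the fidelity with it is at most `1 / p`, before and after local channels
(`IsPhase.eprFidelity_le_of_not_linked`). Hence the authorized pairs of a stabilizer scheme are
exactly the linked ones (`isKnownPartnerESS_stabState_iff`).

Being linked is clearly monotone. The symplectic form of two stabilizers splits as a sum of
contributions `v s` of the parties `s`. For two stabilizers linking `A = {T₁, T₂}`, the vector `v`
sums to zero over `T₁ ∪ T₂` and over the first member of every unauthorized pair with the same
union, but not over `T₁`; by duality the existence of such a vector is the rank condition
(`rank_matM_lt_iff`). Conversely, given a vector `v` for every minimal authorized pair `A`, give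
every party one qudit per `A` and stabilize the block of `A` by the product of the operators `X` and
the product of the operators `Z ^ (v s)` over the parties `s` of `A` (`schemeHom`). The first
stabilizer has full support on `A.union`, so the block links only pairs whose union contains
`A.union`, and the conditions on `v` leave only authorized ones.
-/

noncomputable section

namespace EntanglementSharing

open scoped Matrix Kronecker ComplexOrder

/-! ### Pauli calculus -/

section Pauli

variable {p : ℕ} [NeZero p] {Q : Type*} [Fintype Q]

theorem pauliX_pow_apply (n : ℕ) (i j : ZMod p) :
    (pauliX p ^ n) i j = if i = j + n then 1 else 0 := by
  induction n generalizing j with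
  | zero => simp [Matrix.one_apply]
  | succ n ih =>
    rw [pow_succ, Matrix.mul_apply]
    rw [Finset.sum_eq_single (j + 1)]
    · rw [ih]
      simp [pauliX, add_assoc, add_comm (1 : ZMod p)]
    · intro k _ hk
      simp [pauliX, hk]
    · simp

theorem exp_pow_val (j : ZMod p) :
    Complex.exp (2 * Real.pi * Complex.I / p) ^ j.val = ZMod.stdAddChar j := by
  rw [ZMod.stdAddChar_apply, ZMod.toCircle_apply, ← Complex.exp_nat_mul]
  congr 1
  ring

theorem pauliZ_eq : pauliZ p = Matrix.diagonal fun j => ZMod.stdAddChar j := by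
  simp only [pauliZ, exp_pow_val]

theorem norm_stdAddChar (x : ZMod p) : ‖(ZMod.stdAddChar x : ℂ)‖ = 1 := by
  rw [ZMod.stdAddChar_apply]
  exact Circle.norm_coe _

theorem star_stdAddChar (x : ZMod p) :
    star (ZMod.stdAddChar x : ℂ) = ZMod.stdAddChar (-x) := by
  rw [Complex.star_def, AddChar.map_neg_eq_conj]

theorem stdAddChar_dotProduct (b j : Q → ZMod p) :
    (ZMod.stdAddChar (b ⬝ᵥ j) : ℂ) = ∏ q, ZMod.stdAddChar (b q * j q) :=
  map_prod (ZMod.stdAddChar (N := p)).toMonoidHom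
    (fun q => Multiplicative.ofAdd (b q * j q)) Finset.univ

/-- The Pauli string with exponents `(a, b)` maps `|j⟩` to `ω ^ (b ⬝ j) |j + a⟩`. -/
theorem pauliString_apply (a b i j : Q → ZMod p) :
    pauliString p a b i j = if i = j + a then ZMod.stdAddChar (b ⬝ᵥ j) else 0 := by
  have key : ∀ q, (pauliX p ^ (a q).val * pauliZ p ^ (b q).val) (i q) (j q) =
      if i q = j q + a q then ZMod.stdAddChar (b q * j q) else 0 := by
    intro q
    rw [pauliZ_eq, Matrix.diagonal_pow, Matrix.mul_diagonal, pauliX_pow_apply]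
    simp only [ZMod.natCast_val, ZMod.cast_id', id_eq, Pi.pow_apply, ite_mul, one_mul, zero_mul]
    rw [← AddChar.map_nsmul_eq_pow]
    simp
  simp only [pauliString, Matrix.of_apply, key]
  rw [Finset.prod_ite_zero]
  simp only [Finset.mem_univ, true_implies, funext_iff, Pi.add_apply, stdAddChar_dotProduct]

/-- The exponents `(a, b)` of a Pauli string on the qudits labelled by `Q`. -/
abbrev PauliIndex (p : ℕ) (Q : Type*) : Type _ := (Q → ZMod p) × (Q → ZMod p)

/-- The Pauli string with exponents `w`. -/
def pauli (w : PauliIndex p Q) : Matrix (Q → ZMod p) (Q → ZMod p) ℂ :=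
  pauliString p w.1 w.2

theorem pauli_apply (w : PauliIndex p Q) (i j : Q → ZMod p) :
    pauli w i j = if i = j + w.1 then ZMod.stdAddChar (w.2 ⬝ᵥ j) else 0 :=
  pauliString_apply _ _ _ _

@[simp] theorem pauli_zero : pauli (0 : PauliIndex p Q) = 1 := by
  ext i j
  simp [pauli_apply, Matrix.one_apply]

variable [DecidableEq Q]

theorem pauli_mul (w w' : PauliIndex p Q) :
    pauli w * pauli w' = ZMod.stdAddChar (w.2 ⬝ᵥ w'.1) • pauli (w + w') := by
  ext i j
  rw [Matrix.mul_apply, Finset.sum_eq_single (j + w'.1)]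
  · simp only [pauli_apply, if_true, Matrix.smul_apply, Prod.fst_add, Prod.snd_add, smul_eq_mul,
      dotProduct_add, add_dotProduct, AddChar.map_add_eq_mul, add_assoc, add_comm w'.1 w.1]
    split_ifs <;> ring
  · intro k _ hk
    simp [pauli_apply, hk]
  · simp

theorem pauli_conjTranspose_mul_self (w : PauliIndex p Q) : (pauli w)ᴴ * pauli w = 1 := by
  ext i j
  rw [Matrix.mul_apply, Finset.sum_eq_single (j + w.1)]
  · simp only [Matrix.conjTranspose_apply, pauli_apply, add_left_inj, if_true, Matrix.one_apply]
    by_cases h : j = i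
    · subst h
      simp [star_stdAddChar, ← AddChar.map_add_eq_mul]
    · simp [h, Ne.symm h]
  · intro k _ hk
    simp [pauli_apply, hk]
  · simp

theorem pauli_mul_conjTranspose_self (w : PauliIndex p Q) : pauli w * (pauli w)ᴴ = 1 :=
  mul_eq_one_comm.mp (pauli_conjTranspose_mul_self w)

theorem pauli_pow (w : PauliIndex p Q) (n : ℕ) :
    ∃ c : ℂ, ‖c‖ = 1 ∧ pauli w ^ n = c • pauli (n • w) := by
  induction n with
  | zero => exact ⟨1, by simp⟩
  | succ n ih =>
    obtain ⟨c, hc, h⟩ := ih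
    refine ⟨c * ZMod.stdAddChar ((n • w).2 ⬝ᵥ w.1), by rw [norm_mul, hc, norm_stdAddChar, one_mul],
      ?_⟩
    rw [pow_succ, h, smul_mul_assoc, pauli_mul, smul_smul, succ_nsmul]

theorem nsmul_self_eq_zero {p : ℕ} {Q : Type*} (w : PauliIndex p Q) : p • w = 0 := by
  ext <;> simp

end Pauli

section PauliPrime

variable {p : ℕ} [Fact p.Prime] {Q : Type*} [Fintype Q] [DecidableEq Q]

theorem stdAddChar_ne_one {x : ZMod p} (hx : x ≠ 0) : (ZMod.stdAddChar x : ℂ) ≠ 1 := by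
  intro h
  exact hx (ZMod.injective_stdAddChar (h.trans (AddChar.map_zero_eq_one _).symm))

theorem sum_stdAddChar_dotProduct (b : Q → ZMod p) :
    ∑ j : Q → ZMod p, (ZMod.stdAddChar (b ⬝ᵥ j) : ℂ) =
      if b = 0 then (p : ℂ) ^ Fintype.card Q else 0 := by
  let ψ : AddChar (Q → ZMod p) ℂ :=
    { toFun := fun j => ZMod.stdAddChar (b ⬝ᵥ j)
      map_zero_eq_one' := by simp
      map_add_eq_mul' := by intro x y; simp [dotProduct_add, AddChar.map_add_eq_mul] }
  have h := AddChar.sum_eq_ite ψ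
  have hψ : ψ = 0 ↔ b = 0 := by
    constructor
    · intro h0
      by_contra hb
      obtain ⟨q, hq⟩ := Function.ne_iff.mp hb
      have h1 : ψ (Pi.single q 1) = 1 := by rw [h0]; rfl
      change (ZMod.stdAddChar (b ⬝ᵥ Pi.single q 1) : ℂ) = 1 at h1
      rw [dotProduct_single_one] at h1
      exact stdAddChar_ne_one hq h1
    · rintro rfl
      ext j
      simp [ψ]
  simp only [hψ] at h
  change ∑ j, ψ j = _
  rw [h]
  simp [ZMod.card]

theorem trace_pauli (w : PauliIndex p Q) :
    (pauli w).trace = if w = 0 then (p : ℂ) ^ Fintype.card Q else 0 := by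
  simp only [Matrix.trace, Matrix.diag_apply, pauli_apply]
  by_cases h : w.1 = 0
  · simp only [h, add_zero, if_true, sum_stdAddChar_dotProduct]
    simp [Prod.ext_iff, h]
  · have h' : w ≠ 0 := fun h0 => h (by rw [h0]; rfl)
    simp [h, h']

end PauliPrime

/-! ### Local channels and the EPR state -/

section Extraction

variable {p : ℕ}

/-- For a unitary `V` with `V ^ p = 1`, the spectral projection onto the eigenspace of
eigenvalue `1`. -/
def fixedProj (p : ℕ) {m : Type*} [Fintype m] [DecidableEq m] (V : Matrix m m ℂ) :
    Matrix m m ℂ :=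
  (p : ℂ)⁻¹ • ∑ k ∈ Finset.range p, V ^ k

variable {m : Type*} [Fintype m] [DecidableEq m]

theorem fixedProj_mul (V : Matrix m m ℂ) (hV : V ^ p = 1) :
    fixedProj p V * V = fixedProj p V := by
  have h := Finset.sum_range_succ (fun k => V ^ k) p
  rw [Finset.sum_range_succ', hV, pow_zero, add_left_inj] at h
  rw [fixedProj, smul_mul_assoc, Finset.sum_mul]
  simp only [← pow_succ]
  rw [h]

theorem fixedProj_mul_pow (V : Matrix m m ℂ) (hV : V ^ p = 1) (k : ℕ) :
    fixedProj p V * V ^ k = fixedProj p V := by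
  induction k with
  | zero => simp
  | succ k ih => rw [pow_succ, ← mul_assoc, ih, fixedProj_mul V hV]

variable [Fact p.Prime]

theorem fixedProj_mul_self (V : Matrix m m ℂ) (hV : V ^ p = 1) :
    fixedProj p V * fixedProj p V = fixedProj p V := by
  conv_lhs => rhs; rw [fixedProj]
  rw [mul_smul_comm, Finset.mul_sum]
  simp only [fixedProj_mul_pow V hV, Finset.sum_const, Finset.card_range]
  rw [← Nat.cast_smul_eq_nsmul ℂ, smul_smul,
    inv_mul_cancel₀ (Nat.cast_ne_zero.mpr (NeZero.ne p)), one_smul]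

theorem fixedProj_conjTranspose (V : Matrix m m ℂ) (hV : V ^ p = 1) (hu : Vᴴ * V = 1) :
    (fixedProj p V)ᴴ = fixedProj p V := by
  have h1 : fixedProj p V * Vᴴ = fixedProj p V := by
    conv_lhs => rw [← fixedProj_mul V hV]
    rw [mul_assoc, mul_eq_one_comm.mp hu, mul_one]
  have h2 : ∀ k : ℕ, fixedProj p V * Vᴴ ^ k = fixedProj p V := by
    intro k
    induction k with
    | zero => simp
    | succ k ih => rw [pow_succ, ← mul_assoc, ih, h1]
  have h3 : fixedProj p V * (fixedProj p V)ᴴ = fixedProj p V := by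
    conv_lhs => rhs; rw [fixedProj]
    rw [Matrix.conjTranspose_smul, Matrix.conjTranspose_sum, mul_smul_comm, Finset.mul_sum]
    simp only [Matrix.conjTranspose_pow, h2, Finset.sum_const, Finset.card_range]
    rw [← Nat.cast_smul_eq_nsmul ℂ, smul_smul, star_inv₀, star_natCast,
      inv_mul_cancel₀ (Nat.cast_ne_zero.mpr (NeZero.ne p)), one_smul]
  rw [← h3, Matrix.conjTranspose_mul, Matrix.conjTranspose_conjTranspose]

theorem mul_pow_of_commutation {U V : Matrix m m ℂ} {z : ℂ} (h : V * U = z • (U * V)) (k : ℕ) :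
    V * U ^ k = z ^ k • (U ^ k * V) := by
  induction k with
  | zero => simp
  | succ k ih =>
    rw [pow_succ, ← mul_assoc, ih, smul_mul_assoc, mul_assoc, h, mul_smul_comm, smul_smul,
      ← pow_succ, mul_assoc]

theorem pow_mul_pow_of_commutation {U V : Matrix m m ℂ} {z : ℂ} (h : V * U = z • (U * V))
    (k l : ℕ) : V ^ l * U ^ k = (z ^ k) ^ l • (U ^ k * V ^ l) := by
  induction l with
  | zero => simp
  | succ l ih =>
    rw [pow_succ, mul_assoc, mul_pow_of_commutation h, mul_smul_comm, ← mul_assoc, ih,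
      smul_mul_assoc, smul_smul, mul_assoc, pow_succ, ← pow_succ', pow_succ]

/-- Conjugating the fixed projection of `V` by the powers of `U` gives the spectral projections of
`V`, which sum to the identity. -/
theorem sum_conj_fixedProj {U V : Matrix m m ℂ} (hU' : Uᴴ * U = 1)
    (h : V * U = ZMod.stdAddChar (1 : ZMod p) • (U * V)) :
    ∑ j : ZMod p, U ^ j.val * fixedProj p V * (Uᴴ) ^ j.val = 1 := by
  have hUU : ∀ k : ℕ, U ^ k * Uᴴ ^ k = 1 := by
    intro k
    have hc : Commute U Uᴴ := by
      rw [Commute, SemiconjBy, hU', mul_eq_one_comm.mp hU']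
    rw [← hc.mul_pow, mul_eq_one_comm.mp hU', one_pow]
  have key : ∀ j : ZMod p, ∀ k : ℕ, U ^ j.val * V ^ k * Uᴴ ^ j.val =
      (ZMod.stdAddChar (-(k : ZMod p) * j) : ℂ) • V ^ k := by
    intro j k
    have h1 := pow_mul_pow_of_commutation h j.val k
    rw [← AddChar.map_nsmul_eq_pow, ← AddChar.map_nsmul_eq_pow] at h1
    have h2 : U ^ j.val * V ^ k =
        (ZMod.stdAddChar (-(k : ZMod p) * j) : ℂ) • (V ^ k * U ^ j.val) := by
      rw [h1, smul_smul, ← AddChar.map_add_eq_mul]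
      simp
    rw [h2, smul_mul_assoc, mul_assoc, hUU, mul_one]
  simp only [fixedProj, mul_smul_comm, smul_mul_assoc, Finset.mul_sum, Finset.sum_mul, key]
  rw [← Finset.smul_sum, Finset.sum_comm, Finset.sum_eq_single 0]
  · simp only [Nat.cast_zero, neg_zero, zero_mul, AddChar.map_zero_eq_one, one_smul, pow_zero]
    rw [Finset.sum_const, Finset.card_univ, ZMod.card, ← Nat.cast_smul_eq_nsmul ℂ, smul_smul,
      inv_mul_cancel₀ (Nat.cast_ne_zero.mpr (NeZero.ne p)), one_smul]
  · intro k hk hk0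
    have hk' : -(k : ZMod p) ≠ 0 := by
      rw [neg_ne_zero, Ne, ZMod.natCast_eq_zero_iff]
      exact fun hd => absurd (Nat.le_of_dvd (Nat.pos_of_ne_zero hk0) hd)
        (not_le.mpr (Finset.mem_range.mp hk))
    rw [← Finset.sum_smul]
    have h0 := AddChar.sum_mulShift (R := ZMod p) (R' := ℂ) (-(k : ZMod p))
      (ZMod.isPrimitive_stdAddChar p)
    simp only [hk', if_false, Nat.cast_zero] at h0
    have h1 : ∑ j : ZMod p, (ZMod.stdAddChar (-(k : ZMod p) * j) : ℂ) = 0 := by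
      rw [← h0]
      exact Finset.sum_congr rfl fun j _ => by rw [mul_comm]
    rw [h1, zero_smul]
  · intro h0
    exact absurd (Finset.mem_range.mpr (Nat.pos_of_ne_zero (NeZero.ne p))) h0

/-- Unitaries `U`, `V` with `U ^ p = V ^ p = 1` and the commutation relation of `X` and `Z` define
a virtual `p`-dimensional subsystem, and discarding its complement is a channel that turns `U` and
`V` into `X` and `Z`. -/
theorem exists_channel_intertwining {U V : Matrix m m ℂ} (hU : U ^ p = 1) (hV : V ^ p = 1)
    (hU' : Uᴴ * U = 1) (hV' : Vᴴ * V = 1)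
    (h : V * U = ZMod.stdAddChar (1 : ZMod p) • (U * V)) :
    ∃ N : Channel m (ZMod p), ∀ i, N.kraus i * U = pauliX p * N.kraus i ∧
      N.kraus i * V = pauliZ p * N.kraus i := by
  classical
  -- The row `j` of the Kraus operator labelled by `x` is the row `x` of `fixedProj V * U⁻ʲ`.
  let K : m → Matrix (ZMod p) m ℂ := fun x => Matrix.of fun j y =>
    (fixedProj p V * Uᴴ ^ j.val) x y
  have hK : ∀ x j y, K x j y = (fixedProj p V * Uᴴ ^ j.val) x y := fun _ _ _ => rfl
  have hUp : Uᴴ ^ p = 1 := by rw [← Matrix.conjTranspose_pow, hU, Matrix.conjTranspose_one]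
  have hmodp : ∀ k, Uᴴ ^ (k % p) = Uᴴ ^ k := by
    intro k
    conv_rhs => rw [← Nat.mod_add_div k p, pow_add, pow_mul, hUp, one_pow, mul_one]
  have hstep : ∀ j : ZMod p, Uᴴ ^ j.val * U = Uᴴ ^ (j - 1).val := by
    intro j
    have h1 : Uᴴ ^ j.val = Uᴴ ^ ((j - 1).val + 1) := by
      have hmod : j.val ≡ (j - 1).val + 1 [MOD p] := by
        rw [← ZMod.natCast_eq_natCast_iff]
        simp
      rw [← hmodp, hmod, hmodp]
    rw [h1, pow_succ, mul_assoc, hU', mul_one]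
  have hcomm : Uᴴ * V = ZMod.stdAddChar (1 : ZMod p) • (V * Uᴴ) := by
    have h1 : Uᴴ * (V * U) * Uᴴ = Uᴴ * (ZMod.stdAddChar (1 : ZMod p) • (U * V)) * Uᴴ := by rw [h]
    rw [mul_assoc, mul_assoc, mul_eq_one_comm.mp hU', mul_one, mul_smul_comm, smul_mul_assoc,
      ← mul_assoc, hU', one_mul] at h1
    exact h1
  have hVj : ∀ j : ZMod p, fixedProj p V * Uᴴ ^ j.val * V =
      (ZMod.stdAddChar j : ℂ) • (fixedProj p V * Uᴴ ^ j.val) := by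
    intro j
    have h1 := pow_mul_pow_of_commutation hcomm 1 j.val
    rw [pow_one, pow_one, ← AddChar.map_nsmul_eq_pow] at h1
    rw [mul_assoc, h1, mul_smul_comm, ← mul_assoc, fixedProj_mul V hV]
    simp
  have hcomplete : ∑ x, (K x)ᴴ * K x = 1 := by
    rw [← sum_conj_fixedProj hU' h]
    ext a b
    simp only [Matrix.sum_apply, Matrix.mul_apply (M := (K _)ᴴ), Matrix.conjTranspose_apply, hK]
    rw [Finset.sum_comm]
    refine Finset.sum_congr rfl fun j _ => ?_
    have h1 : U ^ j.val * fixedProj p V * Uᴴ ^ j.val =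
        (fixedProj p V * Uᴴ ^ j.val)ᴴ * (fixedProj p V * Uᴴ ^ j.val) := by
      rw [Matrix.conjTranspose_mul, fixedProj_conjTranspose V hV hV', Matrix.conjTranspose_pow,
        Matrix.conjTranspose_conjTranspose, ← mul_assoc, mul_assoc (U ^ j.val) _ (fixedProj p V),
        fixedProj_mul_self V hV]
    rw [h1, Matrix.mul_apply]
    simp only [Matrix.conjTranspose_apply]
  let e := Fintype.equivFin m
  refine ⟨⟨Fintype.card m, fun i => K (e.symm i), ?_⟩, fun i => ⟨?_, ?_⟩⟩
  · rw [← hcomplete]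
    exact e.symm.sum_comp fun x => (K x)ᴴ * K x
  · ext j y
    rw [Matrix.mul_apply (M := pauliX p), Finset.sum_eq_single (j - 1)]
    · have h1 : (K (e.symm i) * U) j y = (fixedProj p V * Uᴴ ^ j.val * U) (e.symm i) y := rfl
      change (K (e.symm i) * U) j y = _
      rw [h1, mul_assoc, hstep]
      simp [pauliX, hK]
    · intro k _ hk
      have : j ≠ k + 1 := fun h0 => hk (by rw [h0]; ring)
      simp [pauliX, this]
    · simp
  · ext j y
    have h1 : (K (e.symm i) * V) j y = (fixedProj p V * Uᴴ ^ j.val * V) (e.symm i) y := rfl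
    change (K (e.symm i) * V) j y = _
    rw [h1, hVj, pauliZ_eq, Matrix.diagonal_mul]
    simp [hK]

end Extraction

section ApplyProd

variable {m₁ k₁ m₂ k₂ : Type*} [Fintype m₁] [DecidableEq m₁] [Fintype k₁]
  [Fintype m₂] [DecidableEq m₂] [Fintype k₂]

theorem Channel.trace_applyProd (N₁ : Channel m₁ k₁) (N₂ : Channel m₂ k₂)
    (σ : Matrix (m₁ × m₂) (m₁ × m₂) ℂ) : (N₁.applyProd N₂ σ).trace = σ.trace := by
  have h : ∑ i, ∑ j, (Matrix.kronecker (N₁.kraus i) (N₂.kraus j))ᴴ *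
      Matrix.kronecker (N₁.kraus i) (N₂.kraus j) = 1 := by
    have h1 : ∀ i j, (Matrix.kronecker (N₁.kraus i) (N₂.kraus j))ᴴ *
        Matrix.kronecker (N₁.kraus i) (N₂.kraus j) =
        ((N₁.kraus i)ᴴ * N₁.kraus i) ⊗ₖ ((N₂.kraus j)ᴴ * N₂.kraus j) := by
      intro i j
      rw [Matrix.mul_kronecker_mul, ← Matrix.conjTranspose_kronecker]
      rfl
    simp only [h1]
    rw [← Matrix.one_kronecker_one, ← N₁.complete, ← N₂.complete]
    ext a b
    simp only [Matrix.sum_apply, Matrix.kroneckerMap_apply, Finset.sum_mul_sum]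
  rw [Channel.applyProd, Matrix.trace_sum]
  calc _ = ∑ i, ∑ j, ((Matrix.kronecker (N₁.kraus i) (N₂.kraus j))ᴴ *
      Matrix.kronecker (N₁.kraus i) (N₂.kraus j) * σ).trace := by
        refine Finset.sum_congr rfl fun i _ => ?_
        rw [Matrix.trace_sum]
        refine Finset.sum_congr rfl fun j _ => ?_
        rw [Matrix.trace_mul_comm, ← Matrix.mul_assoc]
    _ = σ.trace := by
        simp only [← Matrix.trace_sum, ← Finset.sum_mul, h, one_mul]

theorem Channel.isHermitian_applyProd (N₁ : Channel m₁ k₁) (N₂ : Channel m₂ k₂)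
    {σ : Matrix (m₁ × m₂) (m₁ × m₂) ℂ} (hσ : σ.IsHermitian) :
    (N₁.applyProd N₂ σ).IsHermitian := by
  rw [Matrix.IsHermitian, Channel.applyProd, Matrix.conjTranspose_sum]
  refine Finset.sum_congr rfl fun i _ => ?_
  rw [Matrix.conjTranspose_sum]
  refine Finset.sum_congr rfl fun j _ => ?_
  rw [Matrix.conjTranspose_mul, Matrix.conjTranspose_mul, Matrix.conjTranspose_conjTranspose,
    hσ.eq, Matrix.mul_assoc]

/-- If the channels turn `A₁`, `A₂` into `B₁`, `B₂` and the input is stabilized by `A₁ ⊗ A₂`, then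
the output is stabilized by `B₁ ⊗ B₂`. -/
theorem Channel.mul_applyProd (N₁ : Channel m₁ k₁) (N₂ : Channel m₂ k₂)
    {σ : Matrix (m₁ × m₂) (m₁ × m₂) ℂ} {A₁ : Matrix m₁ m₁ ℂ} {A₂ : Matrix m₂ m₂ ℂ}
    {B₁ : Matrix k₁ k₁ ℂ} {B₂ : Matrix k₂ k₂ ℂ}
    (h₁ : ∀ i, N₁.kraus i * A₁ = B₁ * N₁.kraus i) (h₂ : ∀ i, N₂.kraus i * A₂ = B₂ * N₂.kraus i)
    (hσ : (A₁ ⊗ₖ A₂) * σ = σ) :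
    (B₁ ⊗ₖ B₂) * N₁.applyProd N₂ σ = N₁.applyProd N₂ σ := by
  rw [Channel.applyProd, Finset.mul_sum]
  refine Finset.sum_congr rfl fun i _ => ?_
  rw [Finset.mul_sum]
  refine Finset.sum_congr rfl fun j _ => ?_
  have h : (B₁ ⊗ₖ B₂) * Matrix.kronecker (N₁.kraus i) (N₂.kraus j) =
      Matrix.kronecker (N₁.kraus i) (N₂.kraus j) * (A₁ ⊗ₖ A₂) := by
    change (B₁ ⊗ₖ B₂) * (N₁.kraus i ⊗ₖ N₂.kraus j) = (N₁.kraus i ⊗ₖ N₂.kraus j) * (A₁ ⊗ₖ A₂)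
    rw [← Matrix.mul_kronecker_mul, ← Matrix.mul_kronecker_mul, h₁, h₂]
  rw [← Matrix.mul_assoc, ← Matrix.mul_assoc, h,
    Matrix.mul_assoc (Matrix.kronecker _ _) (A₁ ⊗ₖ A₂), hσ]

end ApplyProd

section EPR

variable {p : ℕ}

theorem eprState_apply (i j : ZMod p × ZMod p) :
    eprState p i j = if i.1 = i.2 ∧ j.1 = j.2 then (p : ℂ)⁻¹ else 0 := by
  have h : (((Real.sqrt p)⁻¹ : ℝ) : ℂ) * (((Real.sqrt p)⁻¹ : ℝ) : ℂ) = (p : ℂ)⁻¹ := by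
    rw [← Complex.ofReal_mul, ← mul_inv, Real.mul_self_sqrt (Nat.cast_nonneg p)]
    simp
  simp only [eprState, Matrix.vecMulVec_apply, eprVec, Pi.star_apply]
  by_cases h1 : i.1 = i.2 <;> by_cases h2 : j.1 = j.2 <;> simp [h1, h2]
  simpa using h

variable [NeZero p]

theorem eprFidelity_eq (σ : Matrix (ZMod p × ZMod p) (ZMod p × ZMod p) ℂ) :
    eprFidelity p σ = (p : ℝ)⁻¹ * ∑ k, ∑ l, (σ (k, k) (l, l)).re := by
  have h : ((((Real.sqrt p)⁻¹ : ℝ) : ℂ) * (((Real.sqrt p)⁻¹ : ℝ) : ℂ)) = (p : ℂ)⁻¹ := by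
    rw [← Complex.ofReal_mul, ← mul_inv, Real.mul_self_sqrt (Nat.cast_nonneg p)]
    simp
  have h1 : star (eprVec p) ⬝ᵥ σ.mulVec (eprVec p) = (p : ℂ)⁻¹ * ∑ k, ∑ l, σ (k, k) (l, l) := by
    have hs : star (eprVec p) = eprVec p := by
      ext k
      simp only [Pi.star_apply, eprVec]
      split_ifs <;> simp
    rw [← h, hs]
    simp only [dotProduct, Matrix.mulVec, Fintype.sum_prod_type, eprVec]
    simp only [ite_mul, mul_ite, zero_mul, mul_zero, Finset.sum_ite_eq, Finset.mem_univ, if_true]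
    simp only [Finset.mul_sum]
    refine Finset.sum_congr rfl fun k _ => Finset.sum_congr rfl fun l _ => by ring
  rw [eprFidelity, h1, ← Complex.ofReal_natCast, ← Complex.ofReal_inv, Complex.re_ofReal_mul]
  simp

theorem eprFidelity_eprState : eprFidelity p (eprState p) = 1 := by
  have hp : (p : ℝ) ≠ 0 := Nat.cast_ne_zero.mpr (NeZero.ne p)
  rw [eprFidelity_eq]
  simp only [eprState_apply, and_self, if_true]
  simp [ZMod.card, ← Complex.ofReal_natCast, ← Complex.ofReal_inv]

/-- The EPR state is the only state stabilized by `X ⊗ X` and `Z ⊗ Z⁻¹`. -/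
theorem eq_eprState_of_stabilized {p : ℕ} [Fact p.Prime]
    {σ : Matrix (ZMod p × ZMod p) (ZMod p × ZMod p) ℂ} (hσ : σ.IsHermitian) (htr : σ.trace = 1)
    (hX : (pauliX p ⊗ₖ pauliX p) * σ = σ) (hZ : (pauliZ p ⊗ₖ (pauliZ p)ᴴ) * σ = σ) :
    σ = eprState p := by
  have hZ' : ∀ i j, i.1 ≠ i.2 → σ i j = 0 := by
    intro i j hij
    have h := congrFun (congrFun hZ i) j
    rw [pauliZ_eq, Matrix.diagonal_conjTranspose, Matrix.diagonal_kronecker_diagonal,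
      Matrix.diagonal_mul, Pi.star_apply, star_stdAddChar, ← AddChar.map_add_eq_mul] at h
    have h1 : (ZMod.stdAddChar (i.1 + -i.2) : ℂ) ≠ 1 :=
      stdAddChar_ne_one (by rwa [← sub_eq_add_neg, sub_ne_zero])
    by_contra h0
    exact h1 (mul_right_cancel₀ h0 (h.trans (one_mul _).symm))
  have hX' : ∀ (i : ZMod p) j, σ (i + 1, i + 1) j = σ (i, i) j := by
    intro i j
    have h := congrFun (congrFun hX (i + 1, i + 1)) j
    rw [← h, Matrix.mul_apply, Finset.sum_eq_single (i, i)]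
    · simp [pauliX]
    · intro k _ hk
      have : ¬ (i = k.1 ∧ i = k.2) := fun h0 => hk (Prod.ext h0.1.symm h0.2.symm)
      simp [pauliX]
      tauto
    · simp
  have hX0 : ∀ (i : ZMod p) j, σ (i, i) j = σ (0, 0) j := by
    intro i j
    have : ∀ n : ℕ, σ ((n : ZMod p), (n : ZMod p)) j = σ (0, 0) j := by
      intro n
      induction n with
      | zero => simp
      | succ n ih => rw [Nat.cast_succ, hX', ih]
    simpa using this i.val
  have hherm : ∀ i j, σ i j = star (σ j i) := fun i j => (hσ.apply i j).symm
  have hc : ∀ i j : ZMod p, σ (i, i) (j, j) = σ (0, 0) (0, 0) := by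
    intro i j
    rw [hX0, hherm, hX0, ← hherm]
  have htr' : (p : ℂ) * σ (0, 0) (0, 0) = 1 := by
    rw [← htr, Matrix.trace]
    simp only [Matrix.diag_apply, Fintype.sum_prod_type]
    have : ∀ i : ZMod p, ∑ j, σ (i, j) (i, j) = σ (0, 0) (0, 0) := by
      intro i
      rw [Finset.sum_eq_single i, hc]
      · intro j _ hj
        exact hZ' _ _ (Ne.symm hj)
      · simp
    simp [this, ZMod.card]
  have hval : σ (0, 0) (0, 0) = (p : ℂ)⁻¹ := eq_inv_of_mul_eq_one_right htr'
  ext ⟨i1, i2⟩ ⟨j1, j2⟩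
  rw [eprState_apply]
  by_cases h1 : i1 = i2
  · by_cases h2 : j1 = j2
    · subst h1 h2
      simp [hc, hval]
    · rw [hherm, hZ' (j1, j2) _ h2]
      simp [h2]
  · rw [hZ' (i1, i2) _ h1]
    simp [h1]

end EPR

section Separability

variable {p : ℕ} [Fact p.Prime] {m₁ m₂ : Type*} [Fintype m₁] [DecidableEq m₁]
  [Fintype m₂] [DecidableEq m₂]

/-- The partial transpose of a bipartite operator on the second factor. -/
def partialTranspose (σ : Matrix (m₁ × m₂) (m₁ × m₂) ℂ) : Matrix (m₁ × m₂) (m₁ × m₂) ℂ :=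
  Matrix.of fun i j => σ (i.1, j.2) (j.1, i.2)

theorem sum_comm_pairs {α β γ δ M : Type*} [Fintype α] [Fintype β] [Fintype γ] [Fintype δ]
    [AddCommMonoid M] (f : α → β → γ → δ → M) :
    ∑ a, ∑ b, ∑ c, ∑ d, f a b c d = ∑ c, ∑ d, ∑ a, ∑ b, f a b c d := by
  have h := Finset.sum_comm (s := Finset.univ) (t := Finset.univ)
    (f := fun (x : α × β) (y : γ × δ) => f x.1 x.2 y.1 y.2)
  simpa only [Fintype.sum_prod_type] using h

theorem re_dotProduct_mulVec_le {n : Type*} [Fintype n] {R : Matrix n n ℂ} (hR : R.PosSemidef)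
    (u v : n → ℂ) : (star u ⬝ᵥ R *ᵥ v).re ≤
      ((star u ⬝ᵥ R *ᵥ u).re + (star v ⬝ᵥ R *ᵥ v).re) / 2 := by
  have h1 := (Complex.le_def.mp (hR.dotProduct_mulVec_nonneg (u - v))).1
  have h2 : star v ⬝ᵥ R *ᵥ u = star (star u ⬝ᵥ R *ᵥ v) := by
    rw [Matrix.star_dotProduct, Matrix.star_mulVec, hR.1.eq, ← Matrix.dotProduct_mulVec]
  simp only [star_sub, Matrix.mulVec_sub, sub_dotProduct, dotProduct_sub, h2, Complex.zero_re,
    Complex.sub_re, Complex.star_def, Complex.conj_re] at h1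
  linarith

/-- A state with positive partial transpose has fidelity at most `1 / p` with the EPR state, and
local channels do not change this: the partial transpose of `Ψ⁺` is `1 / p` times the swap
operator, whose largest eigenvalue is `1 / p`. -/
theorem eprFidelity_applyProd_le {σ : Matrix (m₁ × m₂) (m₁ × m₂) ℂ} (htr : σ.trace = 1)
    (hR : (partialTranspose σ).PosSemidef) (N₁ : Channel m₁ (ZMod p)) (N₂ : Channel m₂ (ZMod p)) :
    eprFidelity p (N₁.applyProd N₂ σ) ≤ (p : ℝ)⁻¹ := by
  set R := partialTranspose σ with hRdef
  let u : Fin N₁.num → Fin N₂.num → ZMod p → ZMod p → m₁ × m₂ → ℂ :=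
    fun i j k l x => star (N₁.kraus i k x.1) * N₂.kraus j l x.2
  have hentry : ∀ k l, (N₁.applyProd N₂ σ) (k, k) (l, l) =
      ∑ i, ∑ j, star (u i j k l) ⬝ᵥ R *ᵥ (u i j l k) := by
    intro k l
    simp only [Channel.applyProd, Matrix.sum_apply]
    refine Finset.sum_congr rfl fun i _ => Finset.sum_congr rfl fun j _ => ?_
    simp only [Matrix.mul_apply, dotProduct, Matrix.mulVec, Fintype.sum_prod_type,
      Finset.sum_mul, Finset.mul_sum, Matrix.conjTranspose_apply, Matrix.kronecker,
      Matrix.kroneckerMap_apply, Matrix.of_apply, Pi.star_apply, u, hRdef, partialTranspose,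
      star_mul', star_star]
    refine (Finset.sum_congr rfl fun _ _ => Finset.sum_comm).trans (Finset.sum_comm.trans
      (Finset.sum_congr rfl fun x _ => Finset.sum_comm.trans (Finset.sum_congr rfl fun y' _ =>
        Finset.sum_congr rfl fun x' _ => Finset.sum_congr rfl fun y _ => by ring)))
  -- By completeness of the Kraus operators the diagonal terms sum to the trace of `R`.
  have hdiag : ∑ i, ∑ j, ∑ k, ∑ l, star (u i j k l) ⬝ᵥ R *ᵥ (u i j k l) = 1 := by
    have h1 : ∀ x x', ∑ i, ∑ k, N₁.kraus i k x * star (N₁.kraus i k x') =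
        if x' = x then 1 else 0 := by
      intro x x'
      have := congrFun (congrFun N₁.complete x') x
      simp only [Matrix.sum_apply, Matrix.mul_apply, Matrix.conjTranspose_apply,
        Matrix.one_apply] at this
      rw [← this]
      exact Finset.sum_congr rfl fun i _ => Finset.sum_congr rfl fun k _ => mul_comm _ _
    have h2 : ∀ x x', ∑ i, ∑ k, star (N₂.kraus i k x) * N₂.kraus i k x' =
        if x = x' then 1 else 0 := by
      intro x x'
      have := congrFun (congrFun N₂.complete x) x'
      simpa only [Matrix.sum_apply, Matrix.mul_apply, Matrix.conjTranspose_apply,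
        Matrix.one_apply] using this
    have h3 : ∀ i j k l, star (u i j k l) ⬝ᵥ R *ᵥ (u i j k l) = ∑ x, ∑ y, ∑ x', ∑ y',
        R (x, y) (x', y') * (N₁.kraus i k x * star (N₁.kraus i k x')) *
          (star (N₂.kraus j l y) * N₂.kraus j l y') := by
      intro i j k l
      simp only [dotProduct, Matrix.mulVec, Fintype.sum_prod_type, Finset.mul_sum, u,
        Pi.star_apply, star_mul', star_star]
      refine Finset.sum_congr rfl fun x _ => Finset.sum_congr rfl fun y _ =>
        Finset.sum_congr rfl fun x' _ => Finset.sum_congr rfl fun y' _ => by ring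
    have h4 : ∀ (c : ℂ) (a : Fin N₁.num → ZMod p → ℂ) (b : Fin N₂.num → ZMod p → ℂ),
        ∑ i, ∑ j, ∑ k, ∑ l, c * a i k * b j l = c * (∑ i, ∑ k, a i k) * ∑ j, ∑ l, b j l := by
      intro c a b
      simp only [← Finset.mul_sum, ← Finset.sum_mul]
    have h5 : ∑ i, ∑ j, ∑ k, ∑ l, star (u i j k l) ⬝ᵥ R *ᵥ (u i j k l) =
        ∑ x, ∑ y, ∑ x', ∑ y', ∑ i, ∑ j, ∑ k, ∑ l,
          R (x, y) (x', y') * (N₁.kraus i k x * star (N₁.kraus i k x')) *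
            (star (N₂.kraus j l y) * N₂.kraus j l y') := by
      have h6 := Finset.sum_comm (s := Finset.univ) (t := Finset.univ)
        (f := fun (a : Fin N₁.num × Fin N₂.num × ZMod p × ZMod p) (b : m₁ × m₂ × m₁ × m₂) =>
          R (b.1, b.2.1) (b.2.2.1, b.2.2.2) *
            (N₁.kraus a.1 a.2.2.1 b.1 * star (N₁.kraus a.1 a.2.2.1 b.2.2.1)) *
            (star (N₂.kraus a.2.1 a.2.2.2 b.2.1) * N₂.kraus a.2.1 a.2.2.2 b.2.2.2))
      simpa only [h3, Fintype.sum_prod_type] using h6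
    rw [h5]
    simp only [h4, h1, h2]
    refine Eq.trans ?_ htr
    simp [Matrix.trace, Fintype.sum_prod_type, hRdef, partialTranspose]
  -- The off-diagonal terms come in pairs `(k, l)`, `(l, k)`, bounded by the diagonal ones.
  have hsum : ∑ k, ∑ l, ((N₁.applyProd N₂ σ) (k, k) (l, l)).re ≤
      ∑ i, ∑ j, ∑ k, ∑ l, (star (u i j k l) ⬝ᵥ R *ᵥ (u i j k l)).re := by
    have h1 : ∀ i j, ∑ k, ∑ l, (star (u i j k l) ⬝ᵥ R *ᵥ (u i j l k)).re ≤
        ∑ k, ∑ l, (star (u i j k l) ⬝ᵥ R *ᵥ (u i j k l)).re := by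
      intro i j
      have h2 : ∑ k, ∑ l, (star (u i j l k) ⬝ᵥ R *ᵥ (u i j l k)).re =
        ∑ k, ∑ l, (star (u i j k l) ⬝ᵥ R *ᵥ (u i j k l)).re := Finset.sum_comm
      calc _ ≤ ∑ k, ∑ l, ((star (u i j k l) ⬝ᵥ R *ᵥ (u i j k l)).re +
            (star (u i j l k) ⬝ᵥ R *ᵥ (u i j l k)).re) / 2 :=
          Finset.sum_le_sum fun k _ => Finset.sum_le_sum fun l _ =>
            re_dotProduct_mulVec_le hR _ _
        _ = _ := by
          simp only [← Finset.sum_div, Finset.sum_add_distrib, h2]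
          ring
    refine le_trans (le_of_eq ?_) (Finset.sum_le_sum fun i _ => Finset.sum_le_sum fun j _ => h1 i j)
    simp only [hentry, Complex.re_sum]
    exact sum_comm_pairs _
  rw [eprFidelity_eq]
  refine mul_le_of_le_one_right (by positivity) (hsum.trans (le_of_eq ?_))
  rw [← Complex.one_re, ← hdiag]
  simp only [Complex.re_sum]

end Separability

/-! ### Stabilizer groups as phase functions on groups of Pauli exponents -/

section GroupSum

variable {G n : Type*} [AddGroup G] [Fintype G] [Fintype n] [DecidableEq n]

theorem conjTranspose_sum_mul_sum {T : G → Matrix n n ℂ} (hadd : ∀ x y, T (x + y) = T x * T y)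
    (hu : ∀ x, (T x)ᴴ * T x = 1) :
    (∑ x, T x)ᴴ * ∑ x, T x = (Fintype.card G : ℂ) • ∑ x, T x := by
  have h : ∀ x, (T x)ᴴ * ∑ y, T y = ∑ y, T y := by
    intro x
    rw [Finset.mul_sum]
    refine Fintype.sum_equiv (Equiv.addLeft (-x)) _ _ fun y => ?_
    conv_lhs => rw [← add_neg_cancel_left x y, hadd, ← mul_assoc, hu, one_mul]
    rfl
  rw [Matrix.conjTranspose_sum, Finset.sum_mul]
  simp only [h, Finset.sum_const, Finset.card_univ]
  rw [← Nat.cast_smul_eq_nsmul ℂ]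

/-- The sum of a finite group of unitaries is a multiple of a projection. -/
theorem posSemidef_sum {T : G → Matrix n n ℂ} (hadd : ∀ x y, T (x + y) = T x * T y)
    (hu : ∀ x, (T x)ᴴ * T x = 1) : (∑ x, T x).PosSemidef := by
  have h : ∑ x, T x = (Fintype.card G : ℂ)⁻¹ • ((∑ x, T x)ᴴ * ∑ x, T x) := by
    rw [conjTranspose_sum_mul_sum hadd hu, smul_smul,
      inv_mul_cancel₀ (Nat.cast_ne_zero.mpr Fintype.card_ne_zero), one_smul]
  rw [h]
  refine (Matrix.posSemidef_conjTranspose_mul_self _).smul ?_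
  rw [← Complex.ofReal_natCast, ← Complex.ofReal_inv]
  exact Complex.zero_le_real.mpr (by positivity)

end GroupSum

section StabilizerData

variable {p : ℕ} [Fact p.Prime] {Q : Type*} [Fintype Q]

theorem pauli_conjTranspose (w : PauliIndex p Q) :
    (pauli w)ᴴ = (ZMod.stdAddChar (w.2 ⬝ᵥ w.1) : ℂ) • pauli (-w) := by
  ext i j
  simp only [Matrix.conjTranspose_apply, pauli_apply, Matrix.smul_apply, Prod.fst_neg,
    Prod.snd_neg, neg_dotProduct, smul_eq_mul]
  by_cases h : j = i + w.1
  · subst h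
    rw [if_pos rfl, if_pos (by simp), star_stdAddChar, ← AddChar.map_add_eq_mul,
      dotProduct_add]
    congr 1
    ring
  · rw [if_neg h, if_neg (fun h0 => h (by rw [h0]; simp))]
    simp

/-- A phase function on an additive group `L` of Pauli exponents: `φ w • pauli w` for `w ∈ L` are
unitaries that multiply as the elements of `L` add. Stabilizer groups are given by such data. -/
structure IsPhase (L : AddSubgroup (PauliIndex p Q)) (φ : PauliIndex p Q → ℂ) : Prop where
  norm : ∀ w ∈ L, ‖φ w‖ = 1
  mul : ∀ w ∈ L, ∀ w' ∈ L, φ w * φ w' * ZMod.stdAddChar (w.2 ⬝ᵥ w'.1) = φ (w + w')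

variable {L : AddSubgroup (PauliIndex p Q)} {φ : PauliIndex p Q → ℂ}

theorem IsPhase.ne_zero (h : IsPhase L φ) {w : PauliIndex p Q} (hw : w ∈ L) : φ w ≠ 0 := by
  intro h0
  simpa [h0] using h.norm w hw

theorem IsPhase.map_zero (h : IsPhase L φ) : φ 0 = 1 := by
  have h1 := h.mul 0 L.zero_mem 0 L.zero_mem
  have h0 := h.ne_zero L.zero_mem
  simp only [Prod.snd_zero, zero_dotProduct, AddChar.map_zero_eq_one, mul_one, add_zero] at h1
  exact mul_right_cancel₀ h0 (h1.trans (one_mul _).symm)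

theorem IsPhase.dotProduct_comm (h : IsPhase L φ) {w w' : PauliIndex p Q} (hw : w ∈ L)
    (hw' : w' ∈ L) : w.2 ⬝ᵥ w'.1 = w'.2 ⬝ᵥ w.1 := by
  apply ZMod.injective_stdAddChar
  have h1 := h.mul w hw w' hw'
  rw [add_comm, ← h.mul w' hw' w hw, mul_comm (φ w')] at h1
  exact mul_left_cancel₀ (mul_ne_zero (h.ne_zero hw) (h.ne_zero hw')) h1

variable [DecidableEq Q]

theorem IsPhase.smul_mul (h : IsPhase L φ) {w w' : PauliIndex p Q} (hw : w ∈ L) (hw' : w' ∈ L) :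
    φ (w + w') • pauli (w + w') = (φ w • pauli w) * (φ w' • pauli w') := by
  rw [smul_mul_assoc, mul_smul_comm, pauli_mul, smul_smul, smul_smul, ← h.mul w hw w' hw',
    mul_assoc]

theorem smul_conjTranspose_mul_smul {m k : Type*} [Fintype m] {c : ℂ} (hc : ‖c‖ = 1)
    (A : Matrix m k ℂ) : (c • A)ᴴ * (c • A) = Aᴴ * A := by
  rw [Matrix.conjTranspose_smul, Matrix.smul_mul, Matrix.mul_smul, smul_smul, Complex.star_def,
    Complex.conj_mul', hc]
  simp

theorem IsPhase.unitary (h : IsPhase L φ) {w : PauliIndex p Q} (hw : w ∈ L) :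
    (φ w • pauli w)ᴴ * (φ w • pauli w) = 1 := by
  rw [smul_conjTranspose_mul_smul (h.norm w hw), pauli_conjTranspose_mul_self]

open Classical in
/-- The sum of the stabilizer group given by `L` and `φ`. -/
def stabSum (L : AddSubgroup (PauliIndex p Q)) (φ : PauliIndex p Q → ℂ) :
    Matrix (Q → ZMod p) (Q → ZMod p) ℂ :=
  ∑ w : L, φ w • pauli (w : PauliIndex p Q)

theorem IsPhase.posSemidef_stabSum (h : IsPhase L φ) : (stabSum L φ).PosSemidef := by
  classical
  exact posSemidef_sum (G := L) (fun x y => h.smul_mul x.2 y.2) (fun x => h.unitary x.2)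

theorem IsPhase.smul_pauli_mul_stabSum (h : IsPhase L φ) {w : PauliIndex p Q} (hw : w ∈ L) :
    (φ w • pauli w) * stabSum L φ = stabSum L φ := by
  classical
  rw [stabSum, Finset.mul_sum]
  refine Fintype.sum_equiv (Equiv.addLeft (⟨w, hw⟩ : L)) _ _ fun y => ?_
  exact (h.smul_mul hw y.2).symm

theorem IsPhase.trace_stabSum (h : IsPhase L φ) :
    (stabSum L φ).trace = (p : ℂ) ^ Fintype.card Q := by
  classical
  rw [stabSum, Matrix.trace_sum, Finset.sum_eq_single 0]
  · rw [Matrix.trace_smul, trace_pauli]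
    simp [h.map_zero]
  · intro w _ hw
    have : (w : PauliIndex p Q) ≠ 0 := fun h0 => hw (Subtype.ext h0)
    rw [Matrix.trace_smul, trace_pauli, if_neg this, smul_zero]
  · simp

open Classical in
/-- The average of the stabilizer group given by `L` and `φ`, which is the projection onto its
common `+1` eigenspace. -/
def stabProj (L : AddSubgroup (PauliIndex p Q)) (φ : PauliIndex p Q → ℂ) :
    Matrix (Q → ZMod p) (Q → ZMod p) ℂ :=
  (Fintype.card L : ℂ)⁻¹ • stabSum L φ

theorem IsPhase.isHermitian_stabProj (h : IsPhase L φ) : (stabProj L φ).IsHermitian := by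
  rw [Matrix.IsHermitian, stabProj, Matrix.conjTranspose_smul, h.posSemidef_stabSum.1.eq]
  simp

theorem IsPhase.stabProj_mul_self (h : IsPhase L φ) :
    stabProj L φ * stabProj L φ = stabProj L φ := by
  classical
  have h1 := conjTranspose_sum_mul_sum (G := L) (T := fun w => φ w • pauli (w : PauliIndex p Q))
    (fun x y => h.smul_mul x.2 y.2) (fun x => h.unitary x.2)
  change (stabSum L φ)ᴴ * stabSum L φ = _ • stabSum L φ at h1
  rw [h.posSemidef_stabSum.1.eq] at h1
  rw [stabProj, smul_mul_assoc, mul_smul_comm, h1, smul_smul (_⁻¹) (Fintype.card L : ℂ),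
    inv_mul_cancel₀ (Nat.cast_ne_zero.mpr Fintype.card_ne_zero), one_smul]

theorem IsPhase.stabProj_mulVec_eq_iff (h : IsPhase L φ) (v : (Q → ZMod p) → ℂ) :
    stabProj L φ *ᵥ v = v ↔ ∀ w ∈ L, (φ w • pauli w) *ᵥ v = v := by
  classical
  constructor
  · intro hv w hw
    rw [← hv, Matrix.mulVec_mulVec, stabProj, mul_smul_comm, h.smul_pauli_mul_stabSum hw]
  · intro hv
    rw [stabProj, stabSum, Matrix.smul_mulVec, Matrix.sum_mulVec]
    simp only [fun w : L => hv w w.2, Finset.sum_const, Finset.card_univ]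
    rw [← Nat.cast_smul_eq_nsmul ℂ, smul_smul,
      inv_mul_cancel₀ (Nat.cast_ne_zero.mpr Fintype.card_ne_zero), one_smul]

/-- The stabilizer state given by `L` and `φ`. -/
def stabState (L : AddSubgroup (PauliIndex p Q)) (φ : PauliIndex p Q → ℂ) :
    Matrix (Q → ZMod p) (Q → ZMod p) ℂ :=
  ((p : ℂ) ^ Fintype.card Q)⁻¹ • stabSum L φ

theorem IsPhase.trace_inv_smul_stabProj (h : IsPhase L φ) :
    (stabProj L φ).trace⁻¹ • stabProj L φ = stabState L φ := by
  classical
  rw [stabState, stabProj, Matrix.trace_smul, h.trace_stabSum, smul_smul, smul_eq_mul, mul_inv,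
    inv_inv, mul_right_comm, mul_inv_cancel₀ (Nat.cast_ne_zero.mpr Fintype.card_ne_zero), one_mul]

theorem IsPhase.isStabilizerState (h : IsPhase L φ) : IsStabilizerState (stabState L φ) := by
  have hmem : ∀ w ∈ L, φ w • pauli w ∈ Matrix.unitaryGroup (Q → ZMod p) ℂ := fun w hw =>
    Matrix.mem_unitaryGroup_iff'.mpr (h.unitary hw)
  let S : Subgroup (Matrix.unitaryGroup (Q → ZMod p) ℂ) :=
    { carrier := {g | ∃ w ∈ L, (g : Matrix (Q → ZMod p) (Q → ZMod p) ℂ) = φ w • pauli w}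
      mul_mem' := by
        rintro g g' ⟨w, hw, hg⟩ ⟨w', hw', hg'⟩
        refine ⟨w + w', L.add_mem hw hw', ?_⟩
        rw [h.smul_mul hw hw', Matrix.UnitaryGroup.mul_val, hg, hg']
      one_mem' := ⟨0, L.zero_mem, by simp [h.map_zero]⟩
      inv_mem' := by
        rintro g ⟨w, hw, hg⟩
        refine ⟨-w, L.neg_mem hw, ?_⟩
        have h1 := h.smul_mul (L.neg_mem hw) hw
        rw [neg_add_cancel, h.map_zero, one_smul, pauli_zero, ← hg] at h1
        rw [Matrix.UnitaryGroup.inv_val]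
        have h2 := congrArg (· * star (g : Matrix (Q → ZMod p) (Q → ZMod p) ℂ)) h1
        simp only [one_mul, mul_assoc, Matrix.mem_unitaryGroup_iff.mp g.2, mul_one] at h2
        exact h2 }
  refine ⟨S, ⟨?_, ?_, ?_⟩, stabProj L φ, h.isHermitian_stabProj, h.stabProj_mul_self, ?_,
    h.trace_inv_smul_stabProj.symm⟩
  · rintro g ⟨w, hw, hg⟩
    exact ⟨φ w, w.1, w.2, h.norm w hw, hg⟩
  · rintro g ⟨w, hw, hg⟩ g' ⟨w', hw', hg'⟩
    apply Subtype.ext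
    rw [Matrix.UnitaryGroup.mul_val, Matrix.UnitaryGroup.mul_val, hg, hg', ← h.smul_mul hw hw',
      ← h.smul_mul hw' hw, add_comm]
  · rintro g ⟨w, hw, hg⟩ c hc
    rw [hg] at hc
    have hw0 : w = 0 := by
      by_contra hne
      have h1 := congrArg Matrix.trace hc
      rw [Matrix.trace_smul, Matrix.trace_smul, trace_pauli, if_neg hne, smul_zero,
        Matrix.trace_one] at h1
      have hc0 : c = 0 := by simpa [NeZero.ne p] using h1.symm
      have h2 := h.unitary hw
      rw [hc, hc0] at h2
      simp at h2
    rw [hw0, h.map_zero, one_smul, pauli_zero] at hc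
    simpa using (congrFun (congrFun hc 0) 0).symm
  · intro v
    rw [h.stabProj_mulVec_eq_iff]
    constructor
    · rintro hv g ⟨w, hw, hg⟩
      rw [hg]
      exact hv w hw
    · intro hv w hw
      exact hv ⟨_, hmem w hw⟩ ⟨w, hw, rfl⟩

theorem IsStabilizerState.exists_eq_stabState {ρ : Matrix (Q → ZMod p) (Q → ZMod p) ℂ}
    (hρ : IsStabilizerState ρ) :
    ∃ (L : AddSubgroup (PauliIndex p Q)) (φ : PauliIndex p Q → ℂ),
      IsPhase L φ ∧ ρ = stabState L φ := by
  classical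
  obtain ⟨S, hS, P, hP, hPP, hfix, rfl⟩ := hρ
  -- `M w c` says that `c • pauli w` lies in the stabilizer group; `c` is then unique.
  let M (w : PauliIndex p Q) (c : ℂ) : Prop := ‖c‖ = 1 ∧
    ∃ g ∈ S, (g : Matrix (Q → ZMod p) (Q → ZMod p) ℂ) = c • pauli w
  have hmul : ∀ w w' c c', M w c → M w' c' →
      M (w + w') (c * c' * ZMod.stdAddChar (w.2 ⬝ᵥ w'.1)) := by
    rintro w w' c c' ⟨hc, g, hg, e⟩ ⟨hc', g', hg', e'⟩
    refine ⟨by rw [norm_mul, norm_mul, hc, hc', norm_stdAddChar]; norm_num, g * g',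
      S.mul_mem hg hg', ?_⟩
    rw [Matrix.UnitaryGroup.mul_val, e, e', smul_mul_assoc, mul_smul_comm, pauli_mul, smul_smul,
      smul_smul, mul_assoc]
  have huniq : ∀ w c c', M w c → M w c' → c = c' := by
    rintro w c c' ⟨hc, g, hg, e⟩ ⟨hc', g', hg', e'⟩
    have h1 := hS.no_phase (g * g'⁻¹) (S.mul_mem hg (S.inv_mem hg')) (c * star c') (by
      rw [Matrix.UnitaryGroup.mul_val, Matrix.UnitaryGroup.inv_val, e, e',
        Matrix.star_eq_conjTranspose, Matrix.conjTranspose_smul, smul_mul_assoc, mul_smul_comm,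
        pauli_mul_conjTranspose_self, smul_smul])
    have h2 : c' * star c' = 1 := by
      rw [Complex.star_def, Complex.mul_conj', hc']; simp
    have h3 : star c' ≠ 0 := fun h0 => by simp [h0] at h2
    exact mul_right_cancel₀ h3 (h1.trans h2.symm)
  have hzero : M 0 1 := ⟨by simp, 1, S.one_mem, by simp⟩
  let L : AddSubgroup (PauliIndex p Q) :=
    { carrier := {w | ∃ c, M w c}
      add_mem' := by
        rintro w w' ⟨c, hc⟩ ⟨c', hc'⟩
        exact ⟨_, hmul w w' c c' hc hc'⟩
      zero_mem' := ⟨1, hzero⟩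
      neg_mem' := by
        rintro w ⟨c, hc, g, hg, e⟩
        refine ⟨star c * ZMod.stdAddChar (w.2 ⬝ᵥ w.1), ?_, g⁻¹, S.inv_mem hg, ?_⟩
        · rw [norm_mul, norm_star, hc, norm_stdAddChar, one_mul]
        · rw [Matrix.UnitaryGroup.inv_val, e, Matrix.star_eq_conjTranspose,
            Matrix.conjTranspose_smul, pauli_conjTranspose, smul_smul] }
  let φ : PauliIndex p Q → ℂ := fun w => if h : w ∈ L then h.choose else 1
  have hφM : ∀ w ∈ L, M w (φ w) := by
    intro w hw
    simp only [φ, hw, dif_pos]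
    exact hw.choose_spec
  have hphase : IsPhase L φ :=
    ⟨fun w hw => (hφM w hw).1, fun w hw w' hw' =>
      huniq _ _ _ (hmul _ _ _ _ (hφM w hw) (hφM w' hw')) (hφM _ (L.add_mem hw hw'))⟩
  refine ⟨L, φ, hphase, ?_⟩
  have hfix' : ∀ v, P *ᵥ v = v ↔ stabProj L φ *ᵥ v = v := by
    intro v
    rw [hfix, hphase.stabProj_mulVec_eq_iff]
    constructor
    · intro hv w hw
      obtain ⟨-, g, hg, e⟩ := hφM w hw
      rw [← e]
      exact hv g hg
    · intro hv g hg
      obtain ⟨c, a, b, hc, e⟩ := hS.pauli g hg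
      have hM : M (a, b) c := ⟨hc, g, hg, e⟩
      have hw : (a, b) ∈ L := ⟨c, hM⟩
      have h1 := hv (a, b) hw
      rw [huniq _ _ _ (hφM _ hw) hM] at h1
      rw [e]
      exact h1
  -- Two Hermitian idempotents with the same range coincide.
  have h1 : P * stabProj L φ = stabProj L φ := by
    refine Matrix.mulVec_injective ?_
    ext1 v
    rw [← Matrix.mulVec_mulVec, (hfix' _).mpr]
    rw [Matrix.mulVec_mulVec, hphase.stabProj_mul_self]
  have h2 : stabProj L φ * P = P := by
    refine Matrix.mulVec_injective ?_
    ext1 v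
    rw [← Matrix.mulVec_mulVec, (hfix' _).mp]
    rw [Matrix.mulVec_mulVec, hPP]
  have h3 : P = stabProj L φ := by
    rw [← h1, ← hP.eq]
    conv_lhs => rw [← h2, Matrix.conjTranspose_mul, hphase.isHermitian_stabProj.eq, hP.eq]
    rw [hP.eq]
  rw [h3, hphase.trace_inv_smul_stabProj]

end StabilizerData

/-! ### Reduced stabilizer states -/

section Splitting

variable {Γ : Type*} [DecidableEq Γ] {Q : Type*} {owner : Q → Γ} {T₁ T₂ : Finset Γ}

/-- The qudits split into those of `T₁`, those of `T₂`, and the rest. -/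
def splitEquiv (owner : Q → Γ) (hT : Disjoint T₁ T₂) :
    Held owner T₁ ⊕ Held owner T₂ ⊕ Rest owner T₁ T₂ ≃ Q :=
  Equiv.ofBijective (Sum.elim Subtype.val (Sum.elim Subtype.val Subtype.val)) (by
    constructor
    · have h12 : ∀ q, owner q ∈ T₁ → owner q ∉ T₂ := fun q h1 h2 =>
        Finset.disjoint_left.mp hT h1 h2
      rintro (⟨q, hq⟩ | ⟨q, hq⟩ | ⟨q, hq⟩) (⟨r, hr⟩ | ⟨r, hr⟩ | ⟨r, hr⟩) h <;>
        simp only [Sum.elim_inl, Sum.elim_inr] at h <;> subst h <;>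
        first | rfl | (have h3 := h12 q; tauto)
    · intro q
      by_cases h1 : owner q ∈ T₁
      · exact ⟨Sum.inl ⟨q, h1⟩, rfl⟩
      by_cases h2 : owner q ∈ T₂
      · exact ⟨Sum.inr (Sum.inl ⟨q, h2⟩), rfl⟩
      exact ⟨Sum.inr (Sum.inr ⟨q, h1, h2⟩), rfl⟩)

theorem sum_split [Fintype Q] (hT : Disjoint T₁ T₂) {M : Type*} [AddCommMonoid M] (f : Q → M) :
    ∑ q, f q = ∑ q : Held owner T₁, f q + (∑ q : Held owner T₂, f q +
      ∑ q : Rest owner T₁ T₂, f q) := by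
  rw [← (splitEquiv owner hT).sum_comp, Fintype.sum_sum_type, Fintype.sum_sum_type]
  rfl

theorem forall_split (hT : Disjoint T₁ T₂) (P : Q → Prop) :
    (∀ q, P q) ↔ (∀ q : Held owner T₁, P q) ∧ (∀ q : Held owner T₂, P q) ∧
      ∀ q : Rest owner T₁ T₂, P q := by
  rw [← (splitEquiv owner hT).forall_congr_right, Sum.forall, Sum.forall]
  rfl

variable {p : ℕ} {x : Held owner T₁ → ZMod p} {y : Held owner T₂ → ZMod p}
  {z : Rest owner T₁ T₂ → ZMod p}

theorem glue_fst (q : Held owner T₁) : glue owner T₁ T₂ x y z q = x q := by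
  simp [glue, q.2]

theorem glue_snd (hT : Disjoint T₁ T₂) (q : Held owner T₂) :
    glue owner T₁ T₂ x y z q = y q := by
  have : owner q ∉ T₁ := fun h => Finset.disjoint_left.mp hT h q.2
  simp [glue, q.2, this]

theorem glue_rest (q : Rest owner T₁ T₂) : glue owner T₁ T₂ x y z q = z q := by
  simp [glue, q.2]

end Splitting

section Reduced

variable {p : ℕ} {Γ : Type*} [DecidableEq Γ] {Q : Type*}

/-- The restriction of Pauli exponents to the qudits satisfying a predicate. -/
def PauliIndex.res (P : Q → Prop) : PauliIndex p Q →+ PauliIndex p {q // P q} where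
  toFun w := (fun q => w.1 q, fun q => w.2 q)
  map_zero' := rfl
  map_add' _ _ := rfl

/-- The symplectic form, which describes the commutation of Pauli strings. -/
def symp [Fintype Q] (w w' : PauliIndex p Q) : ZMod p :=
  w.2 ⬝ᵥ w'.1 - w'.2 ⬝ᵥ w.1

/-- The Pauli exponents of `L` supported on the qudits of `T₁` and `T₂`. -/
def localGroup (owner : Q → Γ) (L : AddSubgroup (PauliIndex p Q)) (T₁ T₂ : Finset Γ) :
    AddSubgroup (PauliIndex p Q) :=
  L ⊓ (PauliIndex.res fun q => owner q ∉ T₁ ∧ owner q ∉ T₂).ker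

/-- `L` links `T₁` to `T₂` if two of its elements supported on `T₁ ∪ T₂` have restrictions to `T₁`
that do not commute. -/
def Linked [Fintype Q] (owner : Q → Γ) (L : AddSubgroup (PauliIndex p Q)) (T₁ T₂ : Finset Γ) :
    Prop :=
  ∃ w ∈ localGroup owner L T₁ T₂, ∃ w' ∈ localGroup owner L T₁ T₂,
    symp (PauliIndex.res (fun q => owner q ∈ T₁) w)
      (PauliIndex.res (fun q => owner q ∈ T₁) w') ≠ 0

theorem posSemidef_pow_inv_smul {n : Type*} {A : Matrix n n ℂ} (hA : A.PosSemidef) (k l : ℕ) :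
    (((p : ℂ) ^ k * (p : ℂ) ^ l)⁻¹ • A).PosSemidef := by
  refine hA.smul ?_
  have h : (((p : ℂ) ^ k * (p : ℂ) ^ l)⁻¹) = (((p : ℝ) ^ k * (p : ℝ) ^ l)⁻¹ : ℝ) := by
    push_cast
    rfl
  rw [h]
  exact Complex.zero_le_real.mpr (by positivity)

variable [Fintype Q] {owner : Q → Γ} {T₁ T₂ : Finset Γ}

variable {L : AddSubgroup (PauliIndex p Q)} {φ : PauliIndex p Q → ℂ}

theorem dotProduct_split (hT : Disjoint T₁ T₂) {w w' : PauliIndex p Q}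
    (hw' : w' ∈ localGroup owner L T₁ T₂) :
    w.2 ⬝ᵥ w'.1 = (PauliIndex.res (fun q => owner q ∈ T₁) w).2 ⬝ᵥ
        (PauliIndex.res (fun q => owner q ∈ T₁) w').1 +
      (PauliIndex.res (fun q => owner q ∈ T₂) w).2 ⬝ᵥ
        (PauliIndex.res (fun q => owner q ∈ T₂) w').1 := by
  rw [dotProduct, sum_split (owner := owner) hT]
  have h : ∑ q : Rest owner T₁ T₂, w.2 q * w'.1 q = 0 := by
    refine Finset.sum_eq_zero fun q _ => ?_
    have h1 : w'.1 q = 0 := congrFun (congrArg Prod.fst (AddMonoidHom.mem_ker.mp hw'.2)) q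
    rw [h1, mul_zero]
  rw [h, add_zero]
  rfl

variable [Fact p.Prime]

theorem pauli_glue (hT : Disjoint T₁ T₂) (w : PauliIndex p Q)
    (x x' : Held owner T₁ → ZMod p) (y y' : Held owner T₂ → ZMod p)
    (z z' : Rest owner T₁ T₂ → ZMod p) :
    pauli w (glue owner T₁ T₂ x y z) (glue owner T₁ T₂ x' y' z') =
      pauli (PauliIndex.res (fun q => owner q ∈ T₁) w) x x' *
      pauli (PauliIndex.res (fun q => owner q ∈ T₂) w) y y' *
      pauli (PauliIndex.res (fun q => owner q ∉ T₁ ∧ owner q ∉ T₂) w) z z' := by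
  have hdot : w.2 ⬝ᵥ glue owner T₁ T₂ x' y' z' =
      (PauliIndex.res (fun q => owner q ∈ T₁) w).2 ⬝ᵥ x' +
      ((PauliIndex.res (fun q => owner q ∈ T₂) w).2 ⬝ᵥ y' +
      (PauliIndex.res (fun q => owner q ∉ T₁ ∧ owner q ∉ T₂) w).2 ⬝ᵥ z') := by
    rw [dotProduct, sum_split (owner := owner) hT]
    simp only [glue_fst, glue_snd hT, glue_rest]
    rfl
  have heq : glue owner T₁ T₂ x y z = glue owner T₁ T₂ x' y' z' + w.1 ↔
      x = x' + (PauliIndex.res (fun q => owner q ∈ T₁) w).1 ∧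
      y = y' + (PauliIndex.res (fun q => owner q ∈ T₂) w).1 ∧
      z = z' + (PauliIndex.res (fun q => owner q ∉ T₁ ∧ owner q ∉ T₂) w).1 := by
    simp only [funext_iff]
    rw [forall_split (owner := owner) hT]
    simp only [Pi.add_apply, glue_fst, glue_snd hT, glue_rest]
    rfl
  simp only [pauli_apply, hdot, heq, AddChar.map_add_eq_mul]
  split_ifs with h h1 h2 h3 <;> first | tauto | ring

variable [DecidableEq Q]

theorem reducedState_pauli (hT : Disjoint T₁ T₂) (w : PauliIndex p Q) :
    reducedState owner (pauli w) T₁ T₂ =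
      (pauli (PauliIndex.res (fun q => owner q ∉ T₁ ∧ owner q ∉ T₂) w)).trace •
      (pauli (PauliIndex.res (fun q => owner q ∈ T₁) w) ⊗ₖ
        pauli (PauliIndex.res (fun q => owner q ∈ T₂) w)) := by
  ext i j
  simp only [reducedState, Matrix.of_apply, pauli_glue hT, ← Finset.mul_sum, Matrix.smul_apply,
    Matrix.kroneckerMap_apply, smul_eq_mul, Matrix.trace, Matrix.diag_apply]
  ring

/-- The Pauli operator `φ w • pauli w` on the qudits of `T₁` and `T₂`, as an operator on a
bipartite system. -/
def bipartitePauli (owner : Q → Γ) (T₁ T₂ : Finset Γ) (φ : PauliIndex p Q → ℂ)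
    (w : PauliIndex p Q) :
    Matrix ((Held owner T₁ → ZMod p) × (Held owner T₂ → ZMod p))
      ((Held owner T₁ → ZMod p) × (Held owner T₂ → ZMod p)) ℂ :=
  φ w • (pauli (PauliIndex.res (fun q => owner q ∈ T₁) w) ⊗ₖ
    pauli (PauliIndex.res (fun q => owner q ∈ T₂) w))

open Classical in
/-- The reduced state of a stabilizer state is the stabilizer state of the stabilizers supported
on the remaining qudits. -/
theorem reducedState_stabState (hT : Disjoint T₁ T₂) :
    reducedState owner (stabState L φ) T₁ T₂ =
      ((p : ℂ) ^ Fintype.card (Held owner T₁) * (p : ℂ) ^ Fintype.card (Held owner T₂))⁻¹ •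
        ∑ w : localGroup owner L T₁ T₂, bipartitePauli owner T₁ T₂ φ w := by
  have hcard : Fintype.card Q = Fintype.card (Held owner T₁) + (Fintype.card (Held owner T₂) +
      Fintype.card (Rest owner T₁ T₂)) := by
    rw [← Fintype.card_congr (splitEquiv owner hT), Fintype.card_sum, Fintype.card_sum]
  have hlin : reducedState owner (stabState L φ) T₁ T₂ = ((p : ℂ) ^ Fintype.card Q)⁻¹ •
      ∑ w : L, φ w • reducedState owner (pauli (w : PauliIndex p Q)) T₁ T₂ := by
    ext i j
    simp only [reducedState, stabState, stabSum, Matrix.of_apply, Matrix.smul_apply,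
      Matrix.sum_apply, smul_eq_mul, ← Finset.mul_sum]
    rw [Finset.sum_comm]
    simp only [← Finset.mul_sum]
  have hp : (p : ℂ) ≠ 0 := Nat.cast_ne_zero.mpr (NeZero.ne p)
  have hsum : ∑ w : L, φ w • reducedState owner (pauli (w : PauliIndex p Q)) T₁ T₂ =
      (p : ℂ) ^ Fintype.card (Rest owner T₁ T₂) •
        ∑ w : localGroup owner L T₁ T₂, bipartitePauli owner T₁ T₂ φ w := by
    have h1 : ∀ w : PauliIndex p Q, φ w • reducedState owner (pauli w) T₁ T₂ =
        if PauliIndex.res (fun q => owner q ∉ T₁ ∧ owner q ∉ T₂) w = 0 then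
          (p : ℂ) ^ Fintype.card (Rest owner T₁ T₂) • bipartitePauli owner T₁ T₂ φ w else 0 := by
      intro w
      rw [reducedState_pauli hT, trace_pauli, bipartitePauli]
      split_ifs
      · rw [smul_comm]
      · simp
    simp only [h1]
    rw [← Finset.sum_subtype (Finset.univ.filter (· ∈ L)) (by simp)
      (fun w => if PauliIndex.res (fun q => owner q ∉ T₁ ∧ owner q ∉ T₂) w = 0 then
          (p : ℂ) ^ Fintype.card (Rest owner T₁ T₂) • bipartitePauli owner T₁ T₂ φ w else 0),
      ← Finset.sum_filter, Finset.filter_filter, ← Finset.smul_sum]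
    congr 1
    exact Finset.sum_subtype _ (by
      intro w
      simp [localGroup, AddSubgroup.mem_inf, AddMonoidHom.mem_ker]) _
  rw [hlin, hsum, smul_smul, hcard, pow_add, pow_add]
  congr 1
  field_simp

theorem IsPhase.bipartitePauli_add (h : IsPhase L φ) (hT : Disjoint T₁ T₂) {w w' : PauliIndex p Q}
    (hw : w ∈ localGroup owner L T₁ T₂) (hw' : w' ∈ localGroup owner L T₁ T₂) :
    bipartitePauli owner T₁ T₂ φ (w + w') =
      bipartitePauli owner T₁ T₂ φ w * bipartitePauli owner T₁ T₂ φ w' := by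
  rw [bipartitePauli, bipartitePauli, bipartitePauli, smul_mul_assoc, mul_smul_comm,
    ← Matrix.mul_kronecker_mul, pauli_mul, pauli_mul, Matrix.smul_kronecker,
    Matrix.kronecker_smul, smul_smul, smul_smul, smul_smul, ← map_add, ← map_add,
    ← h.mul w hw.1 w' hw'.1, dotProduct_split hT hw', AddChar.map_add_eq_mul]
  congr 1
  ring

theorem IsPhase.bipartitePauli_unitary (h : IsPhase L φ) {w : PauliIndex p Q} (hw : w ∈ L) :
    (bipartitePauli owner T₁ T₂ φ w)ᴴ * bipartitePauli owner T₁ T₂ φ w = 1 := by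
  rw [bipartitePauli, smul_conjTranspose_mul_smul (h.norm w hw), Matrix.conjTranspose_kronecker,
    ← Matrix.mul_kronecker_mul, pauli_conjTranspose_mul_self, pauli_conjTranspose_mul_self,
    Matrix.one_kronecker_one]

theorem IsPhase.isHermitian_reducedState (h : IsPhase L φ) (hT : Disjoint T₁ T₂) :
    (reducedState owner (stabState L φ) T₁ T₂).IsHermitian := by
  classical
  rw [reducedState_stabState hT]
  exact (posSemidef_pow_inv_smul (posSemidef_sum (G := localGroup owner L T₁ T₂)
    (fun x y => h.bipartitePauli_add hT x.2 y.2) (fun x => h.bipartitePauli_unitary x.2.1)) _ _).1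

theorem IsPhase.trace_reducedState (h : IsPhase L φ) (hT : Disjoint T₁ T₂) :
    (reducedState owner (stabState L φ) T₁ T₂).trace = 1 := by
  classical
  have hp : (p : ℂ) ≠ 0 := Nat.cast_ne_zero.mpr (NeZero.ne p)
  rw [reducedState_stabState hT, Matrix.trace_smul, Matrix.trace_sum, Finset.sum_eq_single 0]
  · rw [bipartitePauli, Matrix.trace_smul, Matrix.trace_kronecker, trace_pauli, trace_pauli]
    simp only [ZeroMemClass.coe_zero, _root_.map_zero, if_true, h.map_zero, smul_eq_mul, one_mul]
    exact inv_mul_cancel₀ (mul_ne_zero (pow_ne_zero _ hp) (pow_ne_zero _ hp))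
  · intro w _ hw
    rw [bipartitePauli, Matrix.trace_smul, Matrix.trace_kronecker, trace_pauli, trace_pauli]
    have h3 := AddMonoidHom.mem_ker.mp w.2.2
    by_cases h1 : PauliIndex.res (fun q => owner q ∈ T₁) (w : PauliIndex p Q) = 0
    · by_cases h2 : PauliIndex.res (fun q => owner q ∈ T₂) (w : PauliIndex p Q) = 0
      · refine absurd (Subtype.ext ?_) hw
        refine Prod.ext (funext ?_) (funext ?_) <;> rw [forall_split (owner := owner) hT]
        · exact ⟨congrFun (congrArg Prod.fst h1), congrFun (congrArg Prod.fst h2),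
            congrFun (congrArg Prod.fst h3)⟩
        · exact ⟨congrFun (congrArg Prod.snd h1), congrFun (congrArg Prod.snd h2),
            congrFun (congrArg Prod.snd h3)⟩
      · simp [h2]
    · simp [h1]
  · simp

theorem IsPhase.bipartitePauli_mul_reducedState (h : IsPhase L φ) (hT : Disjoint T₁ T₂)
    {w : PauliIndex p Q} (hw : w ∈ localGroup owner L T₁ T₂) :
    bipartitePauli owner T₁ T₂ φ w * reducedState owner (stabState L φ) T₁ T₂ =
      reducedState owner (stabState L φ) T₁ T₂ := by
  classical
  rw [reducedState_stabState hT, mul_smul_comm, Finset.mul_sum]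
  congr 1
  refine Fintype.sum_equiv (Equiv.addLeft (⟨w, hw⟩ : localGroup owner L T₁ T₂)) _ _ fun y => ?_
  exact (h.bipartitePauli_add hT hw y.2).symm

/-- If the restrictions to `T₁` of the stabilizers supported on `T₁ ∪ T₂` commute, then the reduced
state has positive partial transpose: the partial transposes of the stabilizers still form a
group of unitaries. -/
theorem IsPhase.eprFidelity_le_of_not_linked (h : IsPhase L φ) (hT : Disjoint T₁ T₂)
    (hL : ¬ Linked owner L T₁ T₂) (N₁ : Channel (Held owner T₁ → ZMod p) (ZMod p))
    (N₂ : Channel (Held owner T₂ → ZMod p) (ZMod p)) :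
    eprFidelity p (N₁.applyProd N₂ (reducedState owner (stabState L φ) T₁ T₂)) ≤ (p : ℝ)⁻¹ := by
  classical
  refine eprFidelity_applyProd_le (h.trace_reducedState hT) ?_ N₁ N₂
  let T : PauliIndex p Q → Matrix ((Held owner T₁ → ZMod p) × (Held owner T₂ → ZMod p))
      ((Held owner T₁ → ZMod p) × (Held owner T₂ → ZMod p)) ℂ := fun w =>
    φ w • (pauli (PauliIndex.res (fun q => owner q ∈ T₁) w) ⊗ₖ
      (pauli (PauliIndex.res (fun q => owner q ∈ T₂) w))ᵀ)
  have hPT : partialTranspose (reducedState owner (stabState L φ) T₁ T₂) =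
      ((p : ℂ) ^ Fintype.card (Held owner T₁) * (p : ℂ) ^ Fintype.card (Held owner T₂))⁻¹ •
        ∑ w : localGroup owner L T₁ T₂, T w := by
    ext i j
    simp only [partialTranspose, reducedState_stabState hT, Matrix.of_apply, Matrix.smul_apply,
      Matrix.sum_apply, bipartitePauli, T, Matrix.kroneckerMap_apply, Matrix.transpose_apply]
  rw [hPT]
  refine posSemidef_pow_inv_smul (posSemidef_sum (G := localGroup owner L T₁ T₂) ?_ ?_) _ _
  · rintro ⟨w, hw⟩ ⟨w', hw'⟩
    have h1 : symp (PauliIndex.res (fun q => owner q ∈ T₁) w)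
        (PauliIndex.res (fun q => owner q ∈ T₁) w') = 0 := by
      by_contra h0
      exact hL ⟨w, hw, w', hw', h0⟩
    -- The restrictions to `T₁ ∪ T₂` and to `T₁` commute, hence so do those to `T₂`, and the
    -- transposition on `T₂` does not change how the stabilizers multiply.
    have h2 := h.dotProduct_comm hw.1 hw'.1
    rw [dotProduct_split hT hw', dotProduct_split hT hw, sub_eq_zero.mp h1, add_right_inj] at h2
    change T (w + w') = T w * T w'
    simp only [T]
    rw [smul_mul_assoc, mul_smul_comm,
      ← Matrix.mul_kronecker_mul, ← Matrix.transpose_mul, pauli_mul, pauli_mul,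
      Matrix.transpose_smul, Matrix.smul_kronecker,
      Matrix.kronecker_smul, smul_smul, smul_smul, smul_smul, ← map_add, ← map_add,
      ← h.mul w hw.1 w' hw'.1, dotProduct_split hT hw', AddChar.map_add_eq_mul, ← h2,
      add_comm w' w]
    congr 1
    ring
  · rintro ⟨w, hw⟩
    have hconj : ∀ A : Matrix (Held owner T₂ → ZMod p) (Held owner T₂ → ZMod p) ℂ,
        Aᵀᴴ = Aᴴᵀ := fun _ => rfl
    simp only [T]
    rw [smul_conjTranspose_mul_smul (h.norm w hw.1), Matrix.conjTranspose_kronecker,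
      ← Matrix.mul_kronecker_mul, pauli_conjTranspose_mul_self, hconj,
      ← Matrix.transpose_mul, pauli_mul_conjTranspose_self, Matrix.transpose_one,
      Matrix.one_kronecker_one]

theorem exists_channels_of_stabilized {m₁ m₂ : Type*} [Fintype m₁] [DecidableEq m₁]
    [Fintype m₂] [DecidableEq m₂] {σ : Matrix (m₁ × m₂) (m₁ × m₂) ℂ} (hσ : σ.IsHermitian)
    (htr : σ.trace = 1) {U₁ V₁ : Matrix m₁ m₁ ℂ} {U₂ V₂ : Matrix m₂ m₂ ℂ}
    (hU₁ : U₁ᴴ * U₁ = 1) (hV₁ : V₁ᴴ * V₁ = 1) (hU₂ : U₂ᴴ * U₂ = 1) (hV₂ : V₂ᴴ * V₂ = 1)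
    (hU₁p : U₁ ^ p = 1) (hV₁p : V₁ ^ p = 1) (hU₂p : U₂ ^ p = 1) (hV₂p : V₂ ^ p = 1)
    (h₁ : V₁ * U₁ = ZMod.stdAddChar (1 : ZMod p) • (U₁ * V₁))
    (h₂ : U₂ * V₂ = ZMod.stdAddChar (1 : ZMod p) • (V₂ * U₂))
    (hUσ : (U₁ ⊗ₖ U₂) * σ = σ) (hVσ : (V₁ ⊗ₖ V₂) * σ = σ) :
    ∃ (N₁ : Channel m₁ (ZMod p)) (N₂ : Channel m₂ (ZMod p)),
      N₁.applyProd N₂ σ = eprState p := by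
  have h₂' : V₂ᴴ * U₂ = ZMod.stdAddChar (1 : ZMod p) • (U₂ * V₂ᴴ) := by
    have h : V₂ᴴ * (U₂ * V₂) * V₂ᴴ =
        V₂ᴴ * (ZMod.stdAddChar (1 : ZMod p) • (V₂ * U₂)) * V₂ᴴ := by rw [h₂]
    rw [mul_assoc, mul_assoc, mul_eq_one_comm.mp hV₂, mul_one, mul_smul_comm, smul_mul_assoc,
      ← mul_assoc V₂ᴴ V₂, hV₂, one_mul] at h
    exact h
  obtain ⟨N₁, hN₁⟩ := exists_channel_intertwining hU₁p hV₁p hU₁ hV₁ h₁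
  obtain ⟨N₂, hN₂⟩ := exists_channel_intertwining (V := V₂ᴴ) hU₂p
    (by rw [← Matrix.conjTranspose_pow, hV₂p, Matrix.conjTranspose_one]) hU₂
    (by rw [Matrix.conjTranspose_conjTranspose, mul_eq_one_comm.mp hV₂]) h₂'
  have hZ : (pauliZ p)ᴴ * pauliZ p = 1 := by
    rw [pauliZ_eq, Matrix.diagonal_conjTranspose, Matrix.diagonal_mul_diagonal,
      ← Matrix.diagonal_one]
    congr 1
    ext j
    rw [Pi.star_apply, star_stdAddChar, ← AddChar.map_add_eq_mul, neg_add_cancel,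
      AddChar.map_zero_eq_one]
  have hN₂' : ∀ i, N₂.kraus i * V₂ = (pauliZ p)ᴴ * N₂.kraus i := by
    intro i
    have h := congrArg (fun A => (pauliZ p)ᴴ * A * V₂) (hN₂ i).2
    simp only [← Matrix.mul_assoc, hZ, Matrix.one_mul] at h
    rw [← h, Matrix.mul_assoc, hV₂, Matrix.mul_one]
  refine ⟨N₁, N₂, eq_eprState_of_stabilized (N₁.isHermitian_applyProd N₂ hσ)
    ((N₁.trace_applyProd N₂ σ).trans htr) ?_ ?_⟩
  · exact N₁.mul_applyProd N₂ (fun i => (hN₁ i).1) (fun i => (hN₂ i).1) hUσ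
  · exact N₁.mul_applyProd N₂ (fun i => (hN₁ i).2) hN₂' hVσ

theorem exists_phase_pauli_pow (w : PauliIndex p Q) :
    ∃ c : ℂ, ‖c‖ = 1 ∧ (c • pauli w) ^ p = 1 := by
  obtain ⟨d, hd, h⟩ := pauli_pow w p
  have hp : 0 < p := Nat.pos_of_ne_zero (NeZero.ne p)
  obtain ⟨c, hc⟩ := IsAlgClosed.exists_pow_nat_eq d⁻¹ hp
  refine ⟨c, ?_, ?_⟩
  · rw [← pow_eq_one_iff_of_nonneg (norm_nonneg c) hp.ne', ← norm_pow, hc, norm_inv, hd, inv_one]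
  · have hd0 : d ≠ 0 := fun h0 => by simp [h0] at hd
    rw [smul_pow, h, hc, smul_smul, inv_mul_cancel₀ hd0, one_smul, nsmul_self_eq_zero, pauli_zero]

/-- The phase of a stabilizer can be distributed over the two parties so that both factors have
order dividing `p`. -/
theorem IsPhase.exists_phases (h : IsPhase L φ) (hT : Disjoint T₁ T₂) {w : PauliIndex p Q}
    (hw : w ∈ localGroup owner L T₁ T₂) :
    ∃ c d : ℂ, ‖c‖ = 1 ∧ ‖d‖ = 1 ∧
      (c • pauli (PauliIndex.res (fun q => owner q ∈ T₁) w)) ^ p = 1 ∧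
      (d • pauli (PauliIndex.res (fun q => owner q ∈ T₂) w)) ^ p = 1 ∧
      ((c • pauli (PauliIndex.res (fun q => owner q ∈ T₁) w)) ⊗ₖ
        (d • pauli (PauliIndex.res (fun q => owner q ∈ T₂) w))) *
        reducedState owner (stabState L φ) T₁ T₂ = reducedState owner (stabState L φ) T₁ T₂ := by
  obtain ⟨c, hc, hcp⟩ := exists_phase_pauli_pow (PauliIndex.res (fun q => owner q ∈ T₁) w)
  have hc0 : c ≠ 0 := fun h0 => by simp [h0] at hc
  set A := c • pauli (PauliIndex.res (fun q => owner q ∈ T₁) w) with hA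
  set B := (c⁻¹ * φ w) • pauli (PauliIndex.res (fun q => owner q ∈ T₂) w) with hB
  set σ := reducedState owner (stabState L φ) T₁ T₂ with hσ
  have hAB : (A ⊗ₖ B) * σ = σ := by
    rw [hA, hB, Matrix.smul_kronecker, Matrix.kronecker_smul, smul_smul,
      mul_inv_cancel_left₀ hc0]
    exact h.bipartitePauli_mul_reducedState hT hw
  refine ⟨c, c⁻¹ * φ w, hc, by rw [norm_mul, norm_inv, hc, h.norm w hw.1]; norm_num, hcp, ?_, hAB⟩
  obtain ⟨e, -, he⟩ := pauli_pow (PauliIndex.res (fun q => owner q ∈ T₂) w) p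
  have hBp : B ^ p = ((c⁻¹ * φ w) ^ p * e) • 1 := by
    rw [hB, smul_pow, he, smul_smul, nsmul_self_eq_zero, pauli_zero]
  have hpow : ∀ k : ℕ, ((A ^ k) ⊗ₖ (B ^ k)) * σ = σ := by
    intro k
    induction k with
    | zero => simp
    | succ k ih => rw [pow_succ, pow_succ, Matrix.mul_kronecker_mul, mul_assoc, hAB, ih]
  have h1 := congrArg Matrix.trace (hpow p)
  rw [hcp, hBp, Matrix.kronecker_smul, Matrix.one_kronecker_one, smul_mul_assoc, one_mul,
    Matrix.trace_smul, h.trace_reducedState hT, smul_eq_mul, mul_one] at h1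
  change B ^ p = 1
  rw [hBp, h1, one_smul]

theorem pauli_commutation {w w' : PauliIndex p Q} {s : ZMod p} (h : symp w w' = s) :
    pauli w * pauli w' = (ZMod.stdAddChar s : ℂ) • (pauli w' * pauli w) := by
  rw [pauli_mul, pauli_mul, smul_smul, add_comm w' w, ← AddChar.map_add_eq_mul, ← h, symp,
    sub_add_cancel]

/-- Two stabilizers supported on `T₁ ∪ T₂` whose restrictions to `T₁` do not commute give a
shared virtual EPR pair, which local channels extract. -/
theorem IsPhase.exists_channels_of_linked (h : IsPhase L φ) (hT : Disjoint T₁ T₂)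
    (hL : Linked owner L T₁ T₂) :
    ∃ (N₁ : Channel (Held owner T₁ → ZMod p) (ZMod p))
      (N₂ : Channel (Held owner T₂ → ZMod p) (ZMod p)),
      N₁.applyProd N₂ (reducedState owner (stabState L φ) T₁ T₂) = eprState p := by
  obtain ⟨v, hv, u, hu, hvu⟩ := hL
  set s := symp (PauliIndex.res (fun q => owner q ∈ T₁) v)
    (PauliIndex.res (fun q => owner q ∈ T₁) u) with hs
  -- Rescaling the second stabilizer makes the commutator equal to `ω`.
  have hu' : s⁻¹.val • u ∈ localGroup owner L T₁ T₂ := AddSubgroup.nsmul_mem _ hu _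
  set u' := s⁻¹.val • u with hu'def
  have h1 : symp (PauliIndex.res (fun q => owner q ∈ T₁) v)
      (PauliIndex.res (fun q => owner q ∈ T₁) u') = 1 := by
    rw [hu'def, map_nsmul, symp, Prod.smul_fst, Prod.smul_snd, dotProduct_smul, smul_dotProduct,
      ← smul_sub, ← symp, ← hs, nsmul_eq_mul]
    simp [hvu]
  have h2 : symp (PauliIndex.res (fun q => owner q ∈ T₂) u')
      (PauliIndex.res (fun q => owner q ∈ T₂) v) = 1 := by
    have h3 := h.dotProduct_comm hv.1 hu'.1
    rw [dotProduct_split hT hu', dotProduct_split hT hv] at h3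
    rw [← h1, symp, symp]
    linear_combination -h3
  obtain ⟨c, d, hc, hd, hcp, hdp, hcd⟩ := h.exists_phases hT hu'
  obtain ⟨c', d', hc', hd', hcp', hdp', hcd'⟩ := h.exists_phases hT hv
  have hunit : ∀ {R : Type _} [Fintype R] [DecidableEq R] (c : ℂ) (w : PauliIndex p R), ‖c‖ = 1 →
      (c • pauli w)ᴴ * (c • pauli w) = 1 := by
    intro R _ _ c w hc
    rw [smul_conjTranspose_mul_smul hc, pauli_conjTranspose_mul_self]
  refine exists_channels_of_stabilized (h.isHermitian_reducedState hT) (h.trace_reducedState hT)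
    (hunit c _ hc) (hunit c' _ hc') (hunit d _ hd) (hunit d' _ hd') hcp hcp' hdp hdp' ?_ ?_ hcd hcd'
  · rw [smul_mul_assoc, mul_smul_comm, pauli_commutation h1, smul_mul_assoc, mul_smul_comm]
    simp only [smul_smul]
    congr 1
    ring
  · rw [smul_mul_assoc, mul_smul_comm, pauli_commutation h2, smul_mul_assoc, mul_smul_comm]
    simp only [smul_smul]
    congr 1
    ring

end Reduced

/-! ### Access structures of stabilizer states and the rank condition -/

section Characterization

variable {p : ℕ} {Γ : Type*} [DecidableEq Γ] {Q : Type*} {owner : Q → Γ}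

theorem mem_localGroup {L : AddSubgroup (PauliIndex p Q)} {T₁ T₂ : Finset Γ}
    {w : PauliIndex p Q} : w ∈ localGroup owner L T₁ T₂ ↔
      w ∈ L ∧ ∀ q, owner q ∉ T₁ ∪ T₂ → w.1 q = 0 ∧ w.2 q = 0 := by
  rw [localGroup, AddSubgroup.mem_inf, AddMonoidHom.mem_ker, Prod.ext_iff]
  simp only [PauliIndex.res, AddMonoidHom.coe_mk, ZeroHom.coe_mk, Prod.fst_zero, Prod.snd_zero,
    funext_iff, Pi.zero_apply, Subtype.forall, Finset.mem_union, not_or, forall_and]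

variable [Fintype Q]

/-- The contribution of the qudits of one party to the symplectic form. -/
def partyForm (owner : Q → Γ) (w w' : PauliIndex p Q) (s : Γ) : ZMod p :=
  ∑ q with owner q = s, (w.2 q * w'.1 q - w'.2 q * w.1 q)

theorem symp_res_eq_sum_partyForm (T : Finset Γ) (w w' : PauliIndex p Q) :
    symp (PauliIndex.res (fun q => owner q ∈ T) w) (PauliIndex.res (fun q => owner q ∈ T) w') =
      ∑ s ∈ T, partyForm owner w w' s := by
  have h1 : ∑ q with owner q ∈ T, (w.2 q * w'.1 q - w'.2 q * w.1 q) =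
      symp (PauliIndex.res (fun q => owner q ∈ T) w)
        (PauliIndex.res (fun q => owner q ∈ T) w') := by
    rw [symp, dotProduct, dotProduct, ← Finset.sum_sub_distrib]
    exact Finset.sum_subtype _ (by simp) _
  rw [← h1, ← Finset.sum_fiberwise_of_maps_to (g := owner) (t := T) (by simp)]
  refine Finset.sum_congr rfl fun s hs => ?_
  rw [partyForm, Finset.filter_filter]
  refine Finset.sum_congr ?_ fun _ _ => rfl
  ext q
  simp only [Finset.mem_filter, Finset.mem_univ, true_and]
  constructor
  · exact fun h => h.2
  · rintro rfl
    exact ⟨hs, rfl⟩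

theorem Linked.mono {L : AddSubgroup (PauliIndex p Q)} {T₁ T₂ T₃ T₄ : Finset Γ}
    (h : Linked owner L T₁ T₂) (h13 : T₁ ⊆ T₃) (h24 : T₂ ⊆ T₄) (hT : Disjoint T₃ T₄) :
    Linked owner L T₃ T₄ := by
  obtain ⟨w, hw, w', hw', h⟩ := h
  rw [mem_localGroup] at hw hw'
  have hsub : T₁ ∪ T₂ ⊆ T₃ ∪ T₄ := Finset.union_subset_union h13 h24
  refine ⟨w, mem_localGroup.mpr ⟨hw.1, fun q hq => hw.2 q fun h0 => hq (hsub h0)⟩,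
    w', mem_localGroup.mpr ⟨hw'.1, fun q hq => hw'.2 q fun h0 => hq (hsub h0)⟩, ?_⟩
  rw [symp_res_eq_sum_partyForm] at h ⊢
  rwa [← Finset.sum_subset h13]
  intro s hs3 hs1
  refine Finset.sum_eq_zero fun q hq => ?_
  rw [Finset.mem_filter] at hq
  have hq' : owner q ∉ T₁ ∪ T₂ := by
    rw [hq.2, Finset.mem_union]
    rintro (h0 | h0)
    · exact hs1 h0
    · exact Finset.disjoint_left.mp hT hs3 (h24 h0)
  rw [(hw.2 q hq').1, (hw.2 q hq').2, mul_zero, zero_mul, sub_zero]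

variable [Fact p.Prime] [DecidableEq Q]

theorem isKnownPartnerESS_stabState_iff {L : AddSubgroup (PauliIndex p Q)}
    {φ : PauliIndex p Q → ℂ} (h : IsPhase L φ) (𝒜 : Set (PartyPair Γ)) :
    IsKnownPartnerESS owner (stabState L φ) (PairAccessStructure.ofAuthorized 𝒜) ↔
      ∀ X : PartyPair Γ, ∀ T₁ T₂, X.1 = s(T₁, T₂) → (X ∈ 𝒜 ↔ Linked owner L T₁ T₂) := by
  have hp : (p : ℝ)⁻¹ < 1 := inv_lt_one_of_one_lt₀ (by exact_mod_cast (Fact.out : p.Prime).one_lt)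
  constructor
  · rintro ⟨hrec, δ, hδ, hsec⟩ X T₁ T₂ hX
    have hT := X.2 T₁ T₂ hX
    constructor
    · intro hA
      by_contra hL
      obtain ⟨N₁, N₂, hN⟩ := hrec X hA T₁ T₂ hX
      have h1 := h.eprFidelity_le_of_not_linked hT hL N₁ N₂
      rw [hN, eprFidelity_eprState] at h1
      linarith
    · intro hL
      by_contra hA
      obtain ⟨N₁, N₂, hN⟩ := h.exists_channels_of_linked hT hL
      have h1 := hsec X hA T₁ T₂ hX N₁ N₂
      rw [hN, eprFidelity_eprState] at h1
      linarith
  · intro hX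
    refine ⟨fun A hA T₁ T₂ hT => h.exists_channels_of_linked (A.2 _ _ hT) ((hX A _ _ hT).mp hA),
      1 - (p : ℝ)⁻¹, by linarith, fun U hU T₁ T₂ hT N₁ N₂ => ?_⟩
    rw [sub_sub_cancel]
    exact h.eprFidelity_le_of_not_linked (U.2 _ _ hT) (fun hL => hU ((hX U _ _ hT).mpr hL)) N₁ N₂

end Characterization

section Rank

variable {p : ℕ} [Fact p.Prime] {Γ : Type*} [DecidableEq Γ]

theorem PartyPair.union_eq {X : PartyPair Γ} {T₁ T₂ : Finset Γ} (h : X.1 = s(T₁, T₂)) :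
    X.union = T₁ ∪ T₂ := by
  rw [PartyPair.union, h]
  rfl

theorem rank_lt_rank_iff_exists_mulVec {r n K : Type*} [Field K] [Fintype n]
    (M : Matrix r n K) (M' : Matrix (r ⊕ Unit) n K) (hM : ∀ i, M' (Sum.inl i) = M i) :
    M.rank < M'.rank ↔ ∃ v : n → K, M *ᵥ v = 0 ∧ M' (Sum.inr ()) ⬝ᵥ v ≠ 0 := by
  have hker : ∀ v, v ∈ LinearMap.ker M'.mulVecLin ↔
      v ∈ LinearMap.ker M.mulVecLin ∧ M' (Sum.inr ()) ⬝ᵥ v = 0 := by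
    intro v
    simp only [LinearMap.mem_ker, Matrix.mulVecLin_apply, funext_iff, Matrix.mulVec, Sum.forall,
      hM, Pi.zero_apply]
    exact and_congr_right fun _ => ⟨fun h => h (), fun h _ => h⟩
  have h1 := LinearMap.finrank_range_add_finrank_ker M.mulVecLin
  have h2 := LinearMap.finrank_range_add_finrank_ker M'.mulVecLin
  have hle : LinearMap.ker M'.mulVecLin ≤ LinearMap.ker M.mulVecLin := fun v hv =>
    ((hker v).mp hv).1
  have h3 : M.rank < M'.rank ↔ Module.finrank K (LinearMap.ker M'.mulVecLin) <
      Module.finrank K (LinearMap.ker M.mulVecLin) := by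
    rw [Matrix.rank, Matrix.rank]
    omega
  rw [h3]
  constructor
  · intro hlt
    by_contra! hall
    refine hlt.ne (congrArg (fun S : Submodule K (n → K) => Module.finrank K S)
      (le_antisymm hle fun v hv => (hker v).mpr ⟨hv, hall v ?_⟩))
    exact hv
  · rintro ⟨v, hv, hne⟩
    refine Submodule.finrank_lt_finrank_of_lt (lt_of_le_of_ne hle fun heq => ?_)
    have : v ∈ LinearMap.ker M'.mulVecLin := heq ▸ hv
    exact hne ((hker v).mp this).2

/-- By duality, the rank condition asks for a vector that is orthogonal to the rows of `M(A)` but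
not to the indicator of the first component of `A`. -/
theorem rank_matM_lt_iff {ord : PartyPair Γ → Finset Γ × Finset Γ} (hord : IsOrdering ord)
    (𝒮 : PairAccessStructure Γ) (A : PartyPair Γ) :
    (matM p ord 𝒮 A).rank < (matMTilde p ord 𝒮 A).rank ↔
      ∃ v : Γ → ZMod p, (∀ s ∉ A.union, v s = 0) ∧
        (∀ U ∈ 𝒮.unauthorizedOver A, ∑ s ∈ (ord U).1, v s = 0) ∧
        ∑ s ∈ A.union, v s = 0 ∧ ∑ s ∈ (ord A).1, v s ≠ 0 := by
  have hsum : ∀ (X : PartyPair Γ) (v : Γ → ZMod p), X.union = A.union →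
      ∑ s : A.union, (if s.1 ∈ (ord X).1 then 1 else 0) * v s = ∑ s ∈ (ord X).1, v s := by
    intro X v hX
    have hsub : (ord X).1 ⊆ A.union := by
      rw [← hX, PartyPair.union_eq (hord X)]
      exact Finset.subset_union_left
    rw [Finset.sum_coe_sort A.union (fun s => (if s ∈ (ord X).1 then 1 else 0) * v s)]
    simp only [ite_mul, one_mul, zero_mul, ← Finset.sum_filter]
    congr 1
    ext s
    simp only [Finset.mem_filter]
    exact ⟨fun h => h.2, fun h => ⟨hsub h, h⟩⟩
  have hM : ∀ v : Γ → ZMod p, matM p ord 𝒮 A *ᵥ (fun s => v s) = 0 ↔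
      (∀ U ∈ 𝒮.unauthorizedOver A, ∑ s ∈ (ord U).1, v s = 0) ∧ ∑ s ∈ A.union, v s = 0 := by
    intro v
    rw [funext_iff, Sum.forall]
    refine and_congr ?_ ?_
    · rw [Subtype.forall]
      refine forall₂_congr fun U hU => ?_
      rw [← hsum U v hU.2]
      rfl
    · rw [← Finset.sum_coe_sort A.union]
      simp [Matrix.mulVec, dotProduct, matM]
  have hMt : ∀ v : Γ → ZMod p, matMTilde p ord 𝒮 A (Sum.inr ()) ⬝ᵥ (fun s => v s) =
      ∑ s ∈ (ord A).1, v s := by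
    intro v
    rw [← hsum A v rfl]
    rfl
  rw [rank_lt_rank_iff_exists_mulVec _ _ (fun i => by ext s; rfl)]
  constructor
  · rintro ⟨v, hv, hne⟩
    let v' : Γ → ZMod p := fun s => if h : s ∈ A.union then v ⟨s, h⟩ else 0
    have hv' : (fun s : A.union => v' s) = v := by
      ext s
      simp [v']
    rw [← hv'] at hv hne
    rw [hM] at hv
    rw [hMt] at hne
    exact ⟨v', fun s hs => by simp [v', hs], hv.1, hv.2, hne⟩
  · rintro ⟨v, -, hU, hA, hne⟩
    exact ⟨fun s => v s, (hM v).mpr ⟨hU, hA⟩, by rwa [hMt]⟩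

/-- For a vector with total sum zero over a pair, it does not matter which of the two members is
listed first. -/
theorem sum_ord_eq_zero_iff {ord : PartyPair Γ → Finset Γ × Finset Γ} (hord : IsOrdering ord)
    {X : PartyPair Γ} {T₁ T₂ : Finset Γ} (hX : X.1 = s(T₁, T₂)) {v : Γ → ZMod p}
    (hv : ∑ s ∈ X.union, v s = 0) : ∑ s ∈ (ord X).1, v s = 0 ↔ ∑ s ∈ T₁, v s = 0 := by
  rw [PartyPair.union_eq hX, Finset.sum_union (X.2 _ _ hX)] at hv
  have h := hord X
  rw [hX, Sym2.eq_iff] at h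
  rcases h with ⟨h1, -⟩ | ⟨-, h2⟩
  · rw [h1]
  · rw [← h2]
    constructor <;> intro h0 <;> simpa [h0] using hv

end Rank

section Order

variable {Γ : Type*} [DecidableEq Γ]

theorem PartyPair.Below.trans {X Y Z : PartyPair Γ} (h1 : X.Below Y) (h2 : Y.Below Z) :
    X.Below Z := by
  obtain ⟨T₁, T₂, T₃, T₄, hX, hY, h13, h24⟩ := h1
  obtain ⟨A, B, hZ⟩ : ∃ A B, Z.1 = s(A, B) := ⟨_, _, (Quot.out_eq Z.1).symm⟩
  rw [PartyPair.below_iff hY hZ] at h2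
  rw [PartyPair.below_iff hX hZ]
  rcases h2 with ⟨h, h'⟩ | ⟨h, h'⟩
  · exact Or.inl ⟨h13.trans h, h24.trans h'⟩
  · exact Or.inr ⟨h13.trans h, h24.trans h'⟩

theorem PartyPair.StrictlyBelow.card_union_lt {X Y : PartyPair Γ} (h : X.StrictlyBelow Y) :
    X.union.card < Y.union.card := by
  obtain ⟨⟨T₁, T₂, T₃, T₄, hX, hY, h13, h24⟩, hne⟩ := h
  rw [union_eq hX, union_eq hY, Finset.card_union_of_disjoint (X.2 _ _ hX),
    Finset.card_union_of_disjoint (Y.2 _ _ hY)]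
  have h1 := Finset.card_le_card h13
  have h2 := Finset.card_le_card h24
  by_contra hlt
  have e1 := Finset.eq_of_subset_of_card_le h13 (by omega)
  have e2 := Finset.eq_of_subset_of_card_le h24 (by omega)
  exact hne (Subtype.ext (by rw [hX, hY, e1, e2]))

theorem exists_minimalAuthorized_below (𝒮 : PairAccessStructure Γ) {X : PartyPair Γ}
    (hX : X ∈ 𝒮.authorized) : ∃ A ∈ 𝒮.minimalAuthorized, A.Below X := by
  induction hn : X.union.card using Nat.strong_induction_on generalizing X with
  | _ n ih =>
    by_cases hmin : ∃ A' ∈ 𝒮.authorized, A'.StrictlyBelow X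
    · obtain ⟨A', hA', hlt⟩ := hmin
      obtain ⟨A, hA, hAA'⟩ := ih _ (hn ▸ hlt.card_union_lt) hA' rfl
      exact ⟨A, hA, hAA'.trans hlt.1⟩
    · refine ⟨X, ⟨hX, hmin⟩, ?_⟩
      obtain ⟨A, B, hZ⟩ : ∃ A B, X.1 = s(A, B) := ⟨_, _, (Quot.out_eq X.1).symm⟩
      exact ⟨A, B, A, B, hZ, hZ, subset_rfl, subset_rfl⟩

end Order

section Construction

variable {p : ℕ} [Fact p.Prime] {Γ : Type*} [Fintype Γ] [DecidableEq Γ] {ι : Type*} [Fintype ι]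
  {Q : Type*} [Fintype Q]

/-- One qudit for every index `i` and every party, a set `W i` of parties and a vector `v i` for
every `i` give, for every `i`, two operators on the block of `i`: the product of `X` over the
parties in `W i`, and the product of `Z ^ (v i s)` over all parties `s`. The homomorphism sends
`(c, d)` to the Pauli exponents of the product over `i` of their powers `c i` and `d i`. -/
def schemeHom (p : ℕ) (e : Q ≃ ι × Γ) (W : ι → Finset Γ) (v : ι → Γ → ZMod p) :
    (ι → ZMod p) × (ι → ZMod p) →+ PauliIndex p Q where
  toFun c := (fun q => if (e q).2 ∈ W (e q).1 then c.1 (e q).1 else 0,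
    fun q => c.2 (e q).1 * v (e q).1 (e q).2)
  map_zero' := by ext <;> simp
  map_add' c d := by
    refine Prod.ext (funext fun q => ?_) (funext fun q => ?_)
    · by_cases h : (e q).2 ∈ W (e q).1 <;> simp [h]
    · exact add_mul _ _ _

variable {e : Q ≃ ι × Γ} {W : ι → Finset Γ} {v : ι → Γ → ZMod p}

theorem isPhase_schemeHom (hv : ∀ i, ∑ s ∈ W i, v i s = 0) :
    IsPhase (schemeHom p e W v).range (fun _ => 1) := by
  refine ⟨fun _ _ => by simp, ?_⟩
  rintro _ ⟨c, rfl⟩ _ ⟨c', rfl⟩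
  have h : (schemeHom p e W v c).2 ⬝ᵥ (schemeHom p e W v c').1 = 0 := by
    change ∑ q, (c.2 (e q).1 * v (e q).1 (e q).2) *
      (if (e q).2 ∈ W (e q).1 then c'.1 (e q).1 else 0) = 0
    rw [e.sum_comp (fun x => (c.2 x.1 * v x.1 x.2) * (if x.2 ∈ W x.1 then c'.1 x.1 else 0)),
      Fintype.sum_prod_type]
    refine Finset.sum_eq_zero fun i _ => ?_
    have h1 : ∀ s, (c.2 i * v i s) * (if s ∈ W i then c'.1 i else 0) =
        (c.2 i * c'.1 i) * if s ∈ W i then v i s else 0 := by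
      intro s
      split_ifs <;> ring
    simp only [h1, ← Finset.mul_sum]
    rw [← Finset.sum_filter, Finset.filter_univ_mem, hv, mul_zero]
  rw [h]
  simp

theorem sum_partyForm_schemeHom (hW : ∀ i, ∀ s ∉ W i, v i s = 0)
    (c c' : (ι → ZMod p) × (ι → ZMod p)) (T : Finset Γ) :
    ∑ s ∈ T, partyForm (fun q => (e q).2) (schemeHom p e W v c) (schemeHom p e W v c') s =
      ∑ i, (c.2 i * c'.1 i - c'.2 i * c.1 i) * ∑ s ∈ T, v i s := by
  have h1 : ∀ s, partyForm (fun q => (e q).2) (schemeHom p e W v c) (schemeHom p e W v c') s =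
      ∑ i, (c.2 i * c'.1 i - c'.2 i * c.1 i) * v i s := by
    intro s
    rw [partyForm, Finset.sum_filter]
    change ∑ q, (if (e q).2 = s then
      (c.2 (e q).1 * v (e q).1 (e q).2) * (if (e q).2 ∈ W (e q).1 then c'.1 (e q).1 else 0) -
      (c'.2 (e q).1 * v (e q).1 (e q).2) * (if (e q).2 ∈ W (e q).1 then c.1 (e q).1 else 0)
      else 0) = _
    rw [e.sum_comp (fun x => if x.2 = s then
      (c.2 x.1 * v x.1 x.2) * (if x.2 ∈ W x.1 then c'.1 x.1 else 0) -
      (c'.2 x.1 * v x.1 x.2) * (if x.2 ∈ W x.1 then c.1 x.1 else 0) else 0),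
      Fintype.sum_prod_type]
    refine Finset.sum_congr rfl fun i _ => ?_
    rw [Finset.sum_ite_eq' Finset.univ s, if_pos (Finset.mem_univ s)]
    by_cases hs : s ∈ W i
    · simp only [hs, if_true]
      ring
    · simp [hW i s hs]
  simp only [h1]
  rw [Finset.sum_comm]
  simp only [Finset.mul_sum]

end Construction

end EntanglementSharing

end

open EntanglementSharing in
theorem mainTheorem2 (p : ℕ) [Fact p.Prime] {Γ : Type*} [Fintype Γ] [DecidableEq Γ]
    (𝒜 : Set (PartyPair Γ))
    (ord : PartyPair Γ → Finset Γ × Finset Γ) (hord : IsOrdering ord) :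
    RealizableByStabilizer p (PairAccessStructure.ofAuthorized 𝒜) ↔
      (PairAccessStructure.ofAuthorized 𝒜).IsMonotone ∧
      ∀ A ∈ (PairAccessStructure.ofAuthorized 𝒜).minimalAuthorized,
        (matM p ord (PairAccessStructure.ofAuthorized 𝒜) A).rank <
          (matMTilde p ord (PairAccessStructure.ofAuthorized 𝒜) A).rank := by
  constructor
  · rintro ⟨N, owner, ρ, hρ, hess⟩
    obtain ⟨L, φ, hφ, rfl⟩ := hρ.exists_eq_stabState
    rw [isKnownPartnerESS_stabState_iff hφ] at hess
    refine ⟨?_, fun A hA => ?_⟩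
    · rintro A A' hA ⟨T₁, T₂, T₃, T₄, h12, h34, h13, h24⟩
      exact (hess A' _ _ h34).mpr
        (Linked.mono ((hess A _ _ h12).mp hA) h13 h24 (A'.2 _ _ h34))
    · rw [rank_matM_lt_iff hord]
      obtain ⟨w, hw, w', hw', hne⟩ := (hess A _ _ (hord A)).mp hA.1
      have hT := A.2 _ _ (hord A)
      have hcomm := hφ.dotProduct_comm hw.1 hw'.1
      rw [dotProduct_split hT hw', dotProduct_split hT hw] at hcomm
      rw [mem_localGroup, ← PartyPair.union_eq (hord A)] at hw hw'
      refine ⟨partyForm owner w w', fun s hs => Finset.sum_eq_zero fun q hq => ?_,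
        fun U hU => ?_, ?_, ?_⟩
      · have hq' : owner q ∉ A.union := by rwa [(Finset.mem_filter.mp hq).2]
        rw [(hw.2 q hq').1, (hw.2 q hq').2, mul_zero, zero_mul, sub_zero]
      · by_contra h0
        refine hU.1 ((hess U _ _ (hord U)).mpr ⟨w, ?_, w', ?_, ?_⟩)
        · rwa [mem_localGroup, ← PartyPair.union_eq (hord U), hU.2]
        · rwa [mem_localGroup, ← PartyPair.union_eq (hord U), hU.2]
        · rwa [symp_res_eq_sum_partyForm]
      · rw [PartyPair.union_eq (hord A), Finset.sum_union hT, ← symp_res_eq_sum_partyForm,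
          ← symp_res_eq_sum_partyForm, symp, symp]
        linear_combination hcomm
      · rwa [← symp_res_eq_sum_partyForm]
  · rintro ⟨hmono, hrank⟩
    classical
    let ι := {A // A ∈ (PairAccessStructure.ofAuthorized 𝒜).minimalAuthorized}
    have : Finite (PartyPair Γ) := inferInstanceAs (Finite {X : Sym2 (Finset Γ) // _})
    let _ : Fintype ι := Fintype.ofFinite ι
    have hvec := fun A : ι => (rank_matM_lt_iff hord _ _).mp (hrank A A.2)
    choose v hvoff hvU hvsum hvne using hvec
    let e : Fin (Fintype.card (ι × Γ)) ≃ ι × Γ := (Fintype.equivFin (ι × Γ)).symm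
    let W : ι → Finset Γ := fun A => A.1.union
    have hphase : IsPhase (schemeHom p e W v).range (fun _ => 1) := isPhase_schemeHom hvsum
    refine ⟨_, fun q => (e q).2, _, hphase.isStabilizerState,
      (isKnownPartnerESS_stabState_iff hphase 𝒜).mpr fun X T₁ T₂ hX => ⟨fun hXA => ?_, ?_⟩⟩
    · -- The stabilizers of the block of a minimal authorized pair below `X` link `T₁` to `T₂`.
      obtain ⟨A, hA, hAX⟩ :=
        exists_minimalAuthorized_below (PairAccessStructure.ofAuthorized 𝒜) hXA
      obtain ⟨T₃, T₄, hA', h31, h42⟩ : ∃ T₃ T₄, A.1 = s(T₃, T₄) ∧ T₃ ⊆ T₁ ∧ T₄ ⊆ T₂ := by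
        rcases (PartyPair.below_iff (hord A) hX).mp hAX with ⟨h1, h2⟩ | ⟨h1, h2⟩
        · exact ⟨_, _, hord A, h1, h2⟩
        · exact ⟨_, _, (hord A).trans Sym2.eq_swap, h2, h1⟩
      let i : ι := ⟨A, hA⟩
      have hWX : W i ⊆ T₁ ∪ T₂ := by
        rw [show W i = A.union from rfl, PartyPair.union_eq hA']
        exact Finset.union_subset_union h31 h42
      have hmem : ∀ c : (ι → ZMod p) × (ι → ZMod p), (∀ j, j ≠ i → c.1 j = 0 ∧ c.2 j = 0) →
          schemeHom p e W v c ∈ localGroup (fun q => (e q).2) (schemeHom p e W v).range T₁ T₂ := by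
        intro c hc
        refine mem_localGroup.mpr ⟨⟨c, rfl⟩, fun q hq => ?_⟩
        change (if (e q).2 ∈ W (e q).1 then c.1 (e q).1 else 0) = 0 ∧
          c.2 (e q).1 * v (e q).1 (e q).2 = 0
        by_cases hi : (e q).1 = i
        · have hs : (e q).2 ∉ W (e q).1 := by
            rw [hi]
            exact fun h0 => hq (hWX h0)
          exact ⟨if_neg hs, by rw [hvoff _ _ hs, mul_zero]⟩
        · simp [hc _ hi]
      refine ⟨_, hmem (0, Pi.single i 1) (fun j hj => by simp [hj]),
        _, hmem (Pi.single i 1, 0) (fun j hj => by simp [hj]), ?_⟩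
      rw [symp_res_eq_sum_partyForm, sum_partyForm_schemeHom hvoff, Finset.sum_eq_single i]
      · simp only [Pi.single_eq_same, Pi.zero_apply, mul_one, zero_mul, sub_zero, one_mul]
        rw [← Finset.sum_subset h31]
        · exact fun h0 => hvne i ((sum_ord_eq_zero_iff hord hA' (hvsum i)).mpr h0)
        · intro s hs1 hs3
          refine hvoff i s fun hs => ?_
          rw [show i.1.union = A.union from rfl, PartyPair.union_eq hA', Finset.mem_union] at hs
          exact Finset.disjoint_left.mp (X.2 _ _ hX) hs1 (h42 (hs.resolve_left hs3))
      · intro j _ hj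
        simp [hj]
      · simp
    · -- A nonzero commutator comes from the block of some minimal authorized pair `A`; cutting `X`
      -- down to `A.union` gives an authorized pair.
      rintro ⟨_, hw, _, hw', hne⟩
      obtain ⟨⟨c, rfl⟩, hc⟩ := mem_localGroup.mp hw
      obtain ⟨⟨c', rfl⟩, hc'⟩ := mem_localGroup.mp hw'
      rw [symp_res_eq_sum_partyForm, sum_partyForm_schemeHom hvoff] at hne
      obtain ⟨i, -, hi⟩ := Finset.exists_ne_zero_of_sum_ne_zero hne
      have hsub : W i ⊆ T₁ ∪ T₂ := by
        intro s hs
        by_contra hsX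
        have h1 := (hc (e.symm (i, s)) (by simpa using hsX)).1
        have h2 := (hc' (e.symm (i, s)) (by simpa using hsX)).1
        change (if (e (e.symm (i, s))).2 ∈ W (e (e.symm (i, s))).1 then
          c.1 (e (e.symm (i, s))).1 else 0) = 0 at h1
        change (if (e (e.symm (i, s))).2 ∈ W (e (e.symm (i, s))).1 then
          c'.1 (e (e.symm (i, s))).1 else 0) = 0 at h2
        rw [e.apply_symm_apply, if_pos hs] at h1 h2
        apply hi
        rw [h1, h2]
        ring
      have hT : Disjoint (T₁ ∩ W i) (T₂ ∩ W i) :=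
        (X.2 _ _ hX).mono Finset.inter_subset_left Finset.inter_subset_left
      let Y : PartyPair Γ := ⟨s(T₁ ∩ W i, T₂ ∩ W i), by
        intro A B h
        rw [Sym2.eq_iff] at h
        rcases h with ⟨rfl, rfl⟩ | ⟨rfl, rfl⟩
        exacts [hT, hT.symm]⟩
      have hYunion : Y.union = i.1.union := by
        rw [PartyPair.union_eq (X := Y) rfl, ← Finset.union_inter_distrib_right]
        exact Finset.inter_eq_right.mpr hsub
      have hYA : Y ∈ 𝒜 := by
        by_contra hY
        have h1 := (sum_ord_eq_zero_iff hord (X := Y) rfl (by rw [hYunion]; exact hvsum i)).mp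
          (hvU i Y ⟨hY, hYunion⟩)
        refine hi (mul_eq_zero_of_right _ ?_)
        rw [← h1]
        refine (Finset.sum_subset Finset.inter_subset_left
          fun s hs hs' => hvoff i s fun h0 => ?_).symm
        exact hs' (Finset.mem_inter.mpr ⟨hs, h0⟩)
      exact hmono Y X hYA
        ⟨_, _, _, _, rfl, hX, Finset.inter_subset_left, Finset.inter_subset_left⟩
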